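/- Let $\mathbf{k}$ be a field and let $(\mathbb{I},\le)$ be a directed set (a preordered set in which any two elements have an upper bound; $i<j$ means $i\le j$ and $j\not\le i$). **Conventions.** For a small $\mathbf{k}$-linear category $\mathcal{C}$, let $\operatorname{Mod}\mathcal{C}$ be the category of $\mathbf{k}$-linear functors $\mathcal{C}^{\mathrm{op}}\to\operatorname{Mod}\mathbf{k}$ and $\operatorname{mod}\mathcal{C}$ its full subcategory of finitely presented modules, i.e. modules $M$ with an exact sequence $\mathcal{C}(-,y)\to\mathcal{C}(-,x)\to M\to 0$. A small $\mathbf{k}$-linear category $\mathcal{C}$ is a *dualizing $\mathbf{k}$-variety* if it is Hom-finite and Krull–Schmidt (additive, each object being a finite direct sum of indecomposable objects with local endomorphism rings) and $D=\operatorname{Hom}_{\mathbf{k}}(-,\mathbf{k})$ induces dualities $\operatorname{mod}\mathcal{C}\to\operatorname{mod}(\mathcal{C}^{\mathrm{op}})$ and $\operatorname{mod}(\mathcal{C}^{\mathrm{op}})\to\operatorname{mod}\mathcal{C}$. For a $\mathbf{k}$-linear functor $F:\mathcal{C}\to\mathcal{D}$ put $F_*(M)=M\circ F$; it has the right adjoint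 $F^!(M)(y)=\operatorname{Hom}_{\mathcal{C}}(\mathcal{D}(F(-),y),M)$ and the left adjoint $F^*(M)(y)=M\otimes_{\mathcal{C}}\mathcal{D}(y,F(-))$. $F$ is *coherent preserving* if $F_*$ and $F^!$ preserve finitely presented modules. $F$ is *dense* if it is essentially surjective. **Inverse systems and the firm source.** A *$\mathrm{Cat}$-inverse system* $(\mathcal{C}_i,F_{ij},\theta_{ijk})$ over $\mathbb{I}$ consists of small categories $\mathcal{C}_i$, functors $F_{ij}:\mathcal{C}_j\to\mathcal{C}_i$ for $i<j$ and natural isomorphisms $\theta_{ijk}:F_{ij}F_{jk}\Rightarrow F_{ik}$ for $i<j<k$ with $\theta_{ijl}\circ(F_{ij}\theta_{jkl})=\theta_{ikl}\circ(\theta_{ijk}F_{kl})$ for $i<j<k<l$. Its concrete inverse limit $(\mathcal{C},\Phi_i,\Theta_{ij})$ has as objects the families $x=(x_i,f_{ij})$ with $x_i\in\mathcal{C}_i$ and isomorphisms $f_{ij}:F_{ij}(x_j)\to x_i$ $(i<j)$ such that $f_{ij}\circ F_{ij}(f_{jk})=f_{ik}\circ(\theta_{ijk})_{x_k}$ for $i<j<k$;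 morphisms $(x_i,f_{ij})\to(y_i,g_{ij})$ are families $s_i:x_i\to y_i$ with $s_i\circ f_{ij}=g_{ij}\circ F_{ij}(s_j)$; $\Phi_i(x)=x_i$ and $(\Theta_{ij})_x=f_{ij}:F_{ij}\Phi_j(x)\to\Phi_i(x)$. An object $x$ is *firm* if there is $t\in\mathbb{I}$ such that for all $u>t$ and all $a,b\in\mathcal{C}_u$ the maps $\mathcal{C}_u(\Phi_u(x),b)\to\mathcal{C}_t(F_{tu}\Phi_u(x),F_{tu}(b))$ and $\mathcal{C}_u(a,\Phi_u(x))\to\mathcal{C}_t(F_{tu}(a),F_{tu}\Phi_u(x))$ induced by $F_{tu}$ are bijective. The *firm source* $(\dot{\mathcal{C}},\dot\Phi_i,\dot\Theta_{ij})$ is the full subcategory $\dot{\mathcal{C}}\subseteq\mathcal{C}$ of firm objects with the restrictions of $\Phi_i,\Theta_{ij}$; if the $\mathcal{C}_i$ and $F_{ij}$ are $\mathbf{k}$-linear, it is $\mathbf{k}$-linear with componentwise operations. **Admissible targets.** A *direct system* $(\mathcal{A}_i,G_{ij},\zeta_{ijk})$ consists of categories $\mathcal{A}_i$, functors $G_{ij}:\mathcal{A}_i\to\mathcal{A}_j$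 $(i<j)$ and natural isomorphisms $\zeta_{ijk}:G_{jk}G_{ij}\Rightarrow G_{ik}$ with $\zeta_{ikl}\circ(G_{kl}\zeta_{ijk})=\zeta_{ijl}\circ(\zeta_{jkl}G_{ij})$; a *target* $(\mathcal{A},\Psi_i,Z_{ij})$ of it consists of a category $\mathcal{A}$, functors $\Psi_i:\mathcal{A}_i\to\mathcal{A}$ and natural isomorphisms $Z_{ij}:\Psi_jG_{ij}\Rightarrow\Psi_i$ with $Z_{ik}\circ(\Psi_k\zeta_{ijk})=Z_{ij}\circ(Z_{jk}G_{ij})$. If all $\mathcal{A}_i$ are abelian and all $G_{ij}$ are fully faithful and exact, a target together with adjunctions $(L_i,\Psi_i)$ and $(\Psi_i,R_i)$ is *admissible* if: (i) $\mathcal{A}$ is abelian and all $\Psi_i$ are fully faithful; (ii) for every $x\in\mathcal{A}$ there is $t\in\mathbb{I}$ such that for all $u>t$ the unit of $(L_u,\Psi_u)$ and the counit of $(\Psi_u,R_u)$ are isomorphisms at $x$; (iii) for all $x\in\mathcal{A}$ and $n>0$ there is $t\in\mathbb{I}$ such that for all $u>t$, $z\in\mathcal{A}_u$ and $0<r<n$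 we have $\operatorname{Ext}^r_{\mathcal{A}}(x,\Psi_u(z))\cong\operatorname{Ext}^r_{\mathcal{A}_u}(L_u(x),z)$; (iv) for all $y\in\mathcal{A}$ and $n>0$ there is $t\in\mathbb{I}$ such that for all $u>t$, $z\in\mathcal{A}_u$ and $0<r<n$ we have $\operatorname{Ext}^r_{\mathcal{A}}(\Psi_u(z),y)\cong\operatorname{Ext}^r_{\mathcal{A}_u}(z,R_u(y))$. When the categories are $\mathbf{k}$-linear, the isomorphisms in (iii) and (iv) are meant $\mathbf{k}$-linearly. **Statement.** Let $(\mathcal{C}_i,F_{ij},\theta_{ijk})$ be a $\mathrm{Cat}$-inverse system over $\mathbb{I}$ in which all $\mathcal{C}_i$ are dualizing $\mathbf{k}$-varieties and all $F_{ij}$ are $\mathbf{k}$-linear and coherent preserving. Assume that $\dot{\mathcal{C}}$ is a dualizing $\mathbf{k}$-variety and that all $\dot\Phi_i$ are dense, full and coherent preserving. Then the functors $\dot\Phi_i^*$ restrict to functors $\operatorname{mod}\dot{\mathcal{C}}\to\operatorname{mod}\mathcal{C}_i$; the categories $\operatorname{mod}\mathcal{C}_i$ are abelian and the functors $F_{ij*}:\operatorname{mod}\mathcal{C}_i\to\operatorname{mod}\mathcal{C}_j$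 are fully faithful and exact; and $(\operatorname{mod}\dot{\mathcal{C}},\dot\Phi_{i*},\dot\Theta_{ij*})$, together with the adjunctions $(\dot\Phi_i^*,\dot\Phi_{i*})$ and $(\dot\Phi_{i*},\dot\Phi_i^!)$, is an admissible target of the direct system $(\operatorname{mod}\mathcal{C}_i,F_{ij*},\theta_{ijk*})$. Here $(\theta_{ijk*})_M=M(\theta_{ijk}^{-1}):F_{jk*}F_{ij*}(M)\to F_{ik*}(M)$ and $(\dot\Theta_{ij*})_M=M(\dot\Theta_{ij}^{-1}):\dot\Phi_{j*}F_{ij*}(M)\to\dot\Phi_{i*}(M)$. -/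

import Mathlib

open CategoryTheory CategoryTheory.Limits Opposite

universe u v w v' w' uR

namespace AdmTarget

noncomputable section

/-! ### Modules over a `k`-linear category -/

/-- The `k`-linear structure on the opposite of a `k`-linear category. -/
instance linearOpposite (k : Type uR) [Ring k] (C : Type w) [Category.{v} C] [Preadditive C]
    [Linear k C] : Linear k Cᵒᵖ where
  homModule X Y :=
    { smul := fun r f => (r • f.unop).op
      one_smul := fun f => Quiver.Hom.unop_inj (one_smul k f.unop)
      mul_smul := fun r s f => Quiver.Hom.unop_inj (mul_smul r s f.unop)
      smul_zero := fun r => Quiver.Hom.unop_inj (smul_zero (A := (unop Y ⟶ unop X)) r)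
      smul_add := fun r f g => Quiver.Hom.unop_inj (smul_add r f.unop g.unop)
      add_smul := fun r s f => Quiver.Hom.unop_inj (add_smul r s f.unop)
      zero_smul := fun f => Quiver.Hom.unop_inj (zero_smul k f.unop) }
  smul_comp _ _ _ r f g := Quiver.Hom.unop_inj (Linear.comp_smul _ _ _ g.unop r f.unop)
  comp_smul _ _ _ f r g := Quiver.Hom.unop_inj (Linear.smul_comp _ _ _ r g.unop f.unop)

section Modules

variable (k : Type u) [Field k] (C : Type u) [Category.{u} C] [Preadditive C] [Linear k C]

/-- A functor `Cᵒᵖ ⥤ Mod k` is a right `C`-module if it is `k`-linear. -/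
def isModule : ObjectProperty (Cᵒᵖ ⥤ ModuleCat.{u} k) :=
  fun M => M.Additive ∧ M.Linear k

/-- `Mod C`: the category of right `C`-modules. -/
abbrev ModCat : Type (u + 1) := (isModule k C).FullSubcategory

/-- The Yoneda functor `x ↦ C(-, x)` with values in `Mod C`. -/
def yonedaMod : C ⥤ ModCat k C :=
  (isModule k C).lift (linearYoneda k C) fun _ =>
    ⟨inferInstance, ⟨fun f r => by
      ext g
      exact Linear.smul_comp _ _ _ r f.unop g⟩⟩

/-- `M` is finitely presented: there is an exact sequence `C(-, y) ⟶ C(-, x) ⟶ M ⟶ 0`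
(exactness in `Mod C` is pointwise exactness). -/
def isFP : ObjectProperty (ModCat k C) := fun M =>
  ∃ (x y : C) (f : (yonedaMod k C).obj y ⟶ (yonedaMod k C).obj x) (p : (yonedaMod k C).obj x ⟶ M),
    ∀ c : Cᵒᵖ, Function.Exact (f.hom.app c).hom (p.hom.app c).hom ∧
      Function.Surjective (p.hom.app c).hom

/-- `mod C`: the full subcategory of `Mod C` of finitely presented modules. -/
abbrev FPModCat : Type (u + 1) := (isFP k C).FullSubcategory

end Modules

/-! ### Dualizing varieties -/

section Dualizing

variable (k : Type u) [Field k]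

/-- `D = Hom_k(-, k)` on vector spaces. -/
def vectDual : (ModuleCat.{u} k)ᵒᵖ ⥤ ModuleCat.{u} k where
  obj V := ModuleCat.of k (Module.Dual k V.unop)
  map f := ModuleCat.ofHom f.unop.hom.dualMap

variable (C : Type u) [Category.{u} C] [Preadditive C] [Linear k C]

/-- `D : Mod C ⟶ Mod Cᵒᵖ` (contravariant), `(D M)(x) = Hom_k(M(x), k)`. -/
def modDual : (ModCat k C)ᵒᵖ ⥤ ModCat k Cᵒᵖ where
  obj M := ⟨M.unop.obj.op ⋙ vectDual k, by
    obtain ⟨h1, h2⟩ := M.unop.property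
    refine ⟨⟨fun {X Y f g} => ?_⟩, ⟨fun {X Y} f r => ?_⟩⟩
    · ext φ
      refine LinearMap.ext fun m => ?_
      have h := congrArg (fun q => q.hom m) (M.unop.obj.map_add (f := f.unop) (g := g.unop))
      exact (congrArg (DFunLike.coe (F := Module.Dual k _) φ) h).trans
        (LinearMap.map_add (φ : Module.Dual k _) _ _)
    · ext φ
      refine LinearMap.ext fun m => ?_
      have h := congrArg (fun q => q.hom m) (h2.map_smul f.unop r)
      exact (congrArg (DFunLike.coe (F := Module.Dual k _) φ) h).trans
        (LinearMap.map_smul (φ : Module.Dual k _) _ _)⟩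
  map f := ObjectProperty.homMk (Functor.whiskerRight (NatTrans.op f.unop.hom) (vectDual k))

/-- `D : Mod Cᵒᵖ ⟶ Mod C` (contravariant), `(D N)(x) = Hom_k(N(x), k)`. -/
def modDualOp : (ModCat k Cᵒᵖ)ᵒᵖ ⥤ ModCat k C where
  obj N := ⟨(opOp C).op ⋙ N.unop.obj.op ⋙ vectDual k, by
    obtain ⟨h1, h2⟩ := N.unop.property
    refine ⟨⟨fun {X Y f g} => ?_⟩, ⟨fun {X Y} f r => ?_⟩⟩
    · ext φ
      refine LinearMap.ext fun m => ?_
      have h := congrArg (fun q => q.hom m)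
        (N.unop.obj.map_add (f := f.unop.op.op) (g := g.unop.op.op))
      exact (congrArg (DFunLike.coe (F := Module.Dual k _) φ) h).trans
        (LinearMap.map_add (φ : Module.Dual k _) _ _)
    · ext φ
      refine LinearMap.ext fun m => ?_
      have h := congrArg (fun q => q.hom m) (h2.map_smul f.unop.op.op r)
      exact (congrArg (DFunLike.coe (F := Module.Dual k _) φ) h).trans
        (LinearMap.map_smul (φ : Module.Dual k _) _ _)⟩
  map f := ObjectProperty.homMk (Functor.whiskerLeft (opOp C).op
      (Functor.whiskerRight (NatTrans.op f.unop.hom) (vectDual k)))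

/-- A Krull--Schmidt category: an additive category in which every object is a finite direct sum
of indecomposable objects with local endomorphism rings. -/
structure IsKrullSchmidt (C : Type w) [Category.{v} C] [Preadditive C] : Prop where
  hasFiniteBiproducts : HasFiniteBiproducts C
  exists_decomposition : haveI := hasBinaryBiproducts_of_finite_biproducts C
    ∀ x : C, ∃ (n : ℕ) (y : Fin n → C),
      (∀ a, Indecomposable (y a) ∧ IsLocalRing (End (y a))) ∧ Nonempty (x ≅ ⨁ y)

/-- A dualizing `k`-variety: a Hom-finite `k`-linear Krull--Schmidt category such that the two
functors `D = Hom_k(-, k)` restrict to dualities between `mod C` and `mod Cᵒᵖ`. -/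
structure IsDualizingVariety : Prop where
  homFinite : ∀ x y : C, Module.Finite k (x ⟶ y)
  krullSchmidt : IsKrullSchmidt C
  dual_mem : ∀ M : FPModCat k C, isFP k Cᵒᵖ ((modDual k C).obj (op M.obj))
  dualOp_mem : ∀ N : FPModCat k Cᵒᵖ, isFP k C ((modDualOp k C).obj (op N.obj))
  isEquivalence_dual :
    ((isFP k Cᵒᵖ).lift ((isFP k C).ι.op ⋙ modDual k C) fun M => dual_mem M.unop).IsEquivalence
  isEquivalence_dualOp :
    ((isFP k C).lift ((isFP k Cᵒᵖ).ι.op ⋙ modDualOp k C) fun N => dualOp_mem N.unop).IsEquivalence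

end Dualizing

/-! ### Tensor products of modules over a category -/

section Tensor

open TensorProduct Classical

variable {k : Type u} [Field k] {C : Type u} [Category.{u} C]

/-- The relations `(m · f) ⊗ n = m ⊗ (f · n)` defining the tensor product over `C`. -/
def tensorRel (M : Cᵒᵖ ⥤ ModuleCat.{u} k) (N : C ⥤ ModuleCat.{u} k) :
    Submodule k (DirectSum C fun x => M.obj (op x) ⊗[k] N.obj x) :=
  Submodule.span k {z | ∃ (x y : C) (f : x ⟶ y) (m : M.obj (op y)) (n : N.obj x),
    z = DirectSum.lof k C (fun x => M.obj (op x) ⊗[k] N.obj x) x ((M.map f.op).hom m ⊗ₜ n) -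
      DirectSum.lof k C (fun x => M.obj (op x) ⊗[k] N.obj x) y (m ⊗ₜ (N.map f).hom n)}

/-- The tensor product `M ⊗_C N` of a right module `M` and a left module `N`. -/
abbrev TensorOver (M : Cᵒᵖ ⥤ ModuleCat.{u} k) (N : C ⥤ ModuleCat.{u} k) : Type u :=
  (DirectSum C fun x => M.obj (op x) ⊗[k] N.obj x) ⧸ tensorRel M N

/-- The canonical bilinear map `M(x) × N(x) → M ⊗_C N`. -/
def tmulOver (M : Cᵒᵖ ⥤ ModuleCat.{u} k) (N : C ⥤ ModuleCat.{u} k) (x : C) :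
    M.obj (op x) →ₗ[k] N.obj x →ₗ[k] TensorOver M N :=
  (TensorProduct.mk k (M.obj (op x)) (N.obj x)).compr₂
    ((tensorRel M N).mkQ ∘ₗ DirectSum.lof k C (fun x => M.obj (op x) ⊗[k] N.obj x) x)

lemma tmulOver_balanced (M : Cᵒᵖ ⥤ ModuleCat.{u} k) (N : C ⥤ ModuleCat.{u} k) {x y : C} (f : x ⟶ y)
    (m : M.obj (op y)) (n : N.obj x) :
    tmulOver M N x ((M.map f.op).hom m) n = tmulOver M N y m ((N.map f).hom n) :=
  (Submodule.Quotient.eq _).2 (Submodule.subset_span ⟨x, y, f, m, n, rfl⟩)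

/-- A family of bilinear maps that respects the relations induces a map on the tensor product. -/
def tensorLift {M : Cᵒᵖ ⥤ ModuleCat.{u} k} {N : C ⥤ ModuleCat.{u} k} {P : Type u} [AddCommGroup P]
    [Module k P] (φ : ∀ x, M.obj (op x) →ₗ[k] N.obj x →ₗ[k] P)
    (h : ∀ (x y : C) (f : x ⟶ y) (m : M.obj (op y)) (n : N.obj x),
      φ x ((M.map f.op).hom m) n = φ y m ((N.map f).hom n)) :
    TensorOver M N →ₗ[k] P :=
  (tensorRel M N).liftQ (DirectSum.toModule k C P fun x => TensorProduct.lift (φ x)) (by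
    refine Submodule.span_le.2 ?_
    rintro z ⟨x, y, f, m, n, rfl⟩
    simp [h])

@[simp]
lemma tensorLift_tmulOver {M : Cᵒᵖ ⥤ ModuleCat.{u} k} {N : C ⥤ ModuleCat.{u} k} {P : Type u}
    [AddCommGroup P] [Module k P] (φ : ∀ x, M.obj (op x) →ₗ[k] N.obj x →ₗ[k] P) (h) (x : C)
    (m : M.obj (op x)) (n : N.obj x) : tensorLift φ h (tmulOver M N x m n) = φ x m n := by
  change DirectSum.toModule k C P (fun x => TensorProduct.lift (φ x))
    (DirectSum.lof k C (fun x => M.obj (op x) ⊗[k] N.obj x) x (m ⊗ₜ n)) = _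
  simp

lemma tensor_hom_ext {M : Cᵒᵖ ⥤ ModuleCat.{u} k} {N : C ⥤ ModuleCat.{u} k} {P : Type u}
    [AddCommGroup P] [Module k P] {φ ψ : TensorOver M N →ₗ[k] P}
    (h : ∀ x m n, φ (tmulOver M N x m n) = ψ (tmulOver M N x m n)) : φ = ψ := by
  refine Submodule.linearMap_qext _ (DirectSum.linearMap_ext k fun x => ?_)
  exact TensorProduct.ext' fun m n => h x m n

/-- Functoriality of `M ⊗_C N` in `N`. -/
def tensorMapRight (M : Cᵒᵖ ⥤ ModuleCat.{u} k) {N N' : C ⥤ ModuleCat.{u} k} (β : N ⟶ N') :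
    TensorOver M N →ₗ[k] TensorOver M N' :=
  tensorLift (fun x => (tmulOver M N' x).compl₂ (β.app x).hom) (fun x y f m n => by
    have := congrArg (fun q => q.hom n) (β.naturality f)
    simp only [ModuleCat.hom_comp, LinearMap.comp_apply] at this
    simp [tmulOver_balanced, this])

@[simp]
lemma tensorMapRight_tmulOver (M : Cᵒᵖ ⥤ ModuleCat.{u} k) {N N' : C ⥤ ModuleCat.{u} k}
    (β : N ⟶ N') (x : C) (m : M.obj (op x)) (n : N.obj x) :
    tensorMapRight M β (tmulOver M N x m n) = tmulOver M N' x m ((β.app x).hom n) :=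
  tensorLift_tmulOver _ _ x m n

/-- Functoriality of `M ⊗_C N` in `M`. -/
def tensorMapLeft {M M' : Cᵒᵖ ⥤ ModuleCat.{u} k} (α : M ⟶ M') (N : C ⥤ ModuleCat.{u} k) :
    TensorOver M N →ₗ[k] TensorOver M' N :=
  tensorLift (fun x => (tmulOver M' N x) ∘ₗ (α.app (op x)).hom) (fun x y f m n => by
    have := congrArg (fun q => q.hom m) (α.naturality f.op)
    simp only [ModuleCat.hom_comp, LinearMap.comp_apply] at this
    simp [← tmulOver_balanced, this])

@[simp]
lemma tensorMapLeft_tmulOver {M M' : Cᵒᵖ ⥤ ModuleCat.{u} k} (α : M ⟶ M')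
    (N : C ⥤ ModuleCat.{u} k) (x : C) (m : M.obj (op x)) (n : N.obj x) :
    tensorMapLeft α N (tmulOver M N x m n) = tmulOver M' N x ((α.app (op x)).hom m) n :=
  tensorLift_tmulOver _ _ x m n

lemma tensorMapRight_id (M : Cᵒᵖ ⥤ ModuleCat.{u} k) (N : C ⥤ ModuleCat.{u} k) :
    tensorMapRight M (𝟙 N) = LinearMap.id :=
  tensor_hom_ext fun x m n => by simp

lemma tensorMapRight_comp (M : Cᵒᵖ ⥤ ModuleCat.{u} k) {N N' N'' : C ⥤ ModuleCat.{u} k}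
    (β : N ⟶ N') (γ : N' ⟶ N'') :
    tensorMapRight M (β ≫ γ) = tensorMapRight M γ ∘ₗ tensorMapRight M β :=
  tensor_hom_ext fun x m n => by
    rw [LinearMap.comp_apply]
    simp

lemma tensorMap_comm {M M' : Cᵒᵖ ⥤ ModuleCat.{u} k} (α : M ⟶ M') {N N' : C ⥤ ModuleCat.{u} k}
    (β : N ⟶ N') :
    tensorMapLeft α N' ∘ₗ tensorMapRight M β = tensorMapRight M' β ∘ₗ tensorMapLeft α N :=
  tensor_hom_ext fun x m n => by
    rw [LinearMap.comp_apply, LinearMap.comp_apply]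
    simp

end Tensor

/-! ### The functors `F_*`, `F^!`, `F^*` between module categories -/

section Induced

variable (k : Type u) [Field k] {C D : Type u} [Category.{u} C]
  [Category.{u} D] [Preadditive D] [Linear k D] (F : C ⥤ D)

/-- The functor `y ↦ M ⊗_C D(y, F(-))`. -/
def indObj (M : Cᵒᵖ ⥤ ModuleCat.{u} k) : Dᵒᵖ ⥤ ModuleCat.{u} k where
  obj Y := ModuleCat.of k (TensorOver M (F ⋙ (linearCoyoneda k D).obj Y))
  map h := ModuleCat.ofHom (tensorMapRight M (Functor.whiskerLeft F ((linearCoyoneda k D).map h)))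
  map_id Y := ModuleCat.hom_ext (by
    rw [CategoryTheory.Functor.map_id, Functor.whiskerLeft_id', tensorMapRight_id]
    rfl)
  map_comp g h := ModuleCat.hom_ext (by
    rw [Functor.map_comp, Functor.whiskerLeft_comp, tensorMapRight_comp]
    rfl)

/-- The element `m ⊗ g` of `F^*(M)(y)`, for `m ∈ M(x)` and `g : y ⟶ F(x)`. -/
def indMk (M : Cᵒᵖ ⥤ ModuleCat.{u} k) (x : C) (y : D) :
    M.obj (op x) →ₗ[k] (y ⟶ F.obj x) →ₗ[k] (indObj k F M).obj (op y) :=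
  tmulOver M (F ⋙ (linearCoyoneda k D).obj (op y)) x

lemma indMk_balanced (M : Cᵒᵖ ⥤ ModuleCat.{u} k) {x x' : C} (f : x ⟶ x') (y : D)
    (m : M.obj (op x')) (g : y ⟶ F.obj x) :
    indMk k F M x y ((M.map f.op).hom m) g = indMk k F M x' y m (g ≫ F.map f) :=
  tmulOver_balanced M (F ⋙ (linearCoyoneda k D).obj (op y)) f m g

lemma indObj_map_indMk (M : Cᵒᵖ ⥤ ModuleCat.{u} k) (x : C) {y y' : D} (h : y' ⟶ y)
    (m : M.obj (op x)) (g : y ⟶ F.obj x) :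
    ((indObj k F M).map h.op).hom (indMk k F M x y m g) = indMk k F M x y' m (h ≫ g) :=
  tensorMapRight_tmulOver M (Functor.whiskerLeft F ((linearCoyoneda k D).map h.op)) x m g

lemma indObj_hom_ext {M : Cᵒᵖ ⥤ ModuleCat.{u} k} {y : D} {P : ModuleCat.{u} k}
    {φ ψ : (indObj k F M).obj (op y) ⟶ P}
    (h : ∀ x m g, φ.hom (indMk k F M x y m g) = ψ.hom (indMk k F M x y m g)) : φ = ψ :=
  ModuleCat.hom_ext (tensor_hom_ext h)

lemma indObj_isModule (M : Cᵒᵖ ⥤ ModuleCat.{u} k) : isModule k D (indObj k F M) := by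
  refine ⟨⟨fun {X Y f g} => ?_⟩, ⟨fun {X Y} f r => ?_⟩⟩
  · refine indObj_hom_ext k F fun x m n => ?_
    rw [ModuleCat.hom_add, LinearMap.add_apply]
    refine (indObj_map_indMk k F M x (f + g).unop m n).trans ?_
    refine Eq.trans ?_ (congrArg₂ (· + ·) (indObj_map_indMk k F M x f.unop m n)
      (indObj_map_indMk k F M x g.unop m n)).symm
    rw [unop_add, Preadditive.add_comp, map_add]
  · refine indObj_hom_ext k F fun x m n => ?_
    rw [ModuleCat.hom_smul, LinearMap.smul_apply]
    refine (indObj_map_indMk k F M x (r • f.unop) m n).trans ?_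
    refine Eq.trans ?_ (congrArg (r • ·) (indObj_map_indMk k F M x f.unop m n)).symm
    rw [Linear.smul_comp, map_smul]

/-- The map `F^*(M)(y) ⟶ F^*(M')(y)` induced by `α : M ⟶ M'`. -/
def indMap {M M' : Cᵒᵖ ⥤ ModuleCat.{u} k} (α : M ⟶ M') : indObj k F M ⟶ indObj k F M' where
  app Y := ModuleCat.ofHom (tensorMapLeft α (F ⋙ (linearCoyoneda k D).obj Y))
  naturality _ _ f := ModuleCat.hom_ext
    (tensorMap_comm α (Functor.whiskerLeft F ((linearCoyoneda k D).map f)))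

lemma indMap_indMk {M M' : Cᵒᵖ ⥤ ModuleCat.{u} k} (α : M ⟶ M') (x : C) (y : D)
    (m : M.obj (op x)) (g : y ⟶ F.obj x) :
    ((indMap k F α).app (op y)).hom (indMk k F M x y m g) =
      indMk k F M' x y ((α.app (op x)).hom m) g :=
  tensorMapLeft_tmulOver α (F ⋙ (linearCoyoneda k D).obj (op y)) x m g

/-- The bilinear map `(m, g) ↦ N(g)(ψ(m))` given by `ψ : M ⟶ N ∘ F`. -/
def indBilin {M : Cᵒᵖ ⥤ ModuleCat.{u} k} {N : Dᵒᵖ ⥤ ModuleCat.{u} k} (hN : isModule k D N)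
    (ψ : M ⟶ F.op ⋙ N) (x : C) (y : D) :
    M.obj (op x) →ₗ[k] (y ⟶ F.obj x) →ₗ[k] N.obj (op y) :=
  LinearMap.mk₂ k
    (fun m g => (N.map g.op).hom ((ψ.app (op x)).hom m))
    (fun m m' g => by
      rw [map_add]
      exact map_add _ _ _)
    (fun r m g => by
      rw [map_smul]
      exact map_smul _ _ _)
    (fun m g g' => by
      have := hN.1
      exact congrArg (fun q => q.hom ((ψ.app (op x)).hom m))
        (N.map_add (f := g.op) (g := g'.op)))
    (fun r m g => congrArg (fun q => q.hom ((ψ.app (op x)).hom m)) (hN.2.map_smul g.op r))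

lemma indBilin_balanced {M : Cᵒᵖ ⥤ ModuleCat.{u} k} {N : Dᵒᵖ ⥤ ModuleCat.{u} k}
    (hN : isModule k D N) (ψ : M ⟶ F.op ⋙ N) {x x' : C} (f : x ⟶ x') (y : D)
    (m : M.obj (op x')) (g : y ⟶ F.obj x) :
    indBilin k F hN ψ x y ((M.map f.op).hom m) g = indBilin k F hN ψ x' y m (g ≫ F.map f) := by
  have h1 := congrArg (fun q => q.hom m) (ψ.naturality f.op)
  have h2 := congrArg (fun q => q.hom ((ψ.app (op x')).hom m))
    (N.map_comp (F.map f).op g.op)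
  exact (congrArg (N.map g.op).hom h1).trans h2.symm

/-- The linear map `F^*(M)(y) → N(y)`, `m ⊗ g ↦ N(g)(ψ(m))`, given by `ψ : M ⟶ N ∘ F`. -/
def indLiftApp {M : Cᵒᵖ ⥤ ModuleCat.{u} k} {N : Dᵒᵖ ⥤ ModuleCat.{u} k} (hN : isModule k D N)
    (ψ : M ⟶ F.op ⋙ N) (y : D) : (indObj k F M).obj (op y) →ₗ[k] N.obj (op y) :=
  tensorLift (M := M) (N := F ⋙ (linearCoyoneda k D).obj (op y))
    (fun x => indBilin k F hN ψ x y) (fun _ _ f m g => indBilin_balanced k F hN ψ f y m g)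

lemma indLiftApp_indMk {M : Cᵒᵖ ⥤ ModuleCat.{u} k} {N : Dᵒᵖ ⥤ ModuleCat.{u} k}
    (hN : isModule k D N) (ψ : M ⟶ F.op ⋙ N) (x : C) (y : D) (m : M.obj (op x))
    (g : y ⟶ F.obj x) :
    indLiftApp k F hN ψ y (indMk k F M x y m g) = (N.map g.op).hom ((ψ.app (op x)).hom m) :=
  tensorLift_tmulOver (M := M) (N := F ⋙ (linearCoyoneda k D).obj (op y))
    (fun x => indBilin k F hN ψ x y) (fun _ _ f m g => indBilin_balanced k F hN ψ f y m g) x m g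

/-- The natural transformation `F^*(M) ⟶ N` corresponding to `ψ : M ⟶ N ∘ F`. -/
def indLift {M : Cᵒᵖ ⥤ ModuleCat.{u} k} {N : Dᵒᵖ ⥤ ModuleCat.{u} k} (hN : isModule k D N)
    (ψ : M ⟶ F.op ⋙ N) : indObj k F M ⟶ N where
  app Y := ModuleCat.ofHom (indLiftApp k F hN ψ Y.unop)
  naturality X Y f := indObj_hom_ext k F fun x m g => by
    have h1 := indObj_map_indMk k F M x f.unop m g
    have h2 := congrArg (fun q => q.hom ((ψ.app (op x)).hom m)) (N.map_comp g.op f)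
    exact ((congrArg (indLiftApp k F hN ψ Y.unop) h1).trans
      (indLiftApp_indMk k F hN ψ x Y.unop m _)).trans (h2.trans
        (congrArg (N.map f).hom (indLiftApp_indMk k F hN ψ x X.unop m g).symm))

lemma indLift_indMk {M : Cᵒᵖ ⥤ ModuleCat.{u} k} {N : Dᵒᵖ ⥤ ModuleCat.{u} k} (hN : isModule k D N)
    (ψ : M ⟶ F.op ⋙ N) (x : C) (y : D) (m : M.obj (op x)) (g : y ⟶ F.obj x) :
    ((indLift k F hN ψ).app (op y)).hom (indMk k F M x y m g) =
      (N.map g.op).hom ((ψ.app (op x)).hom m) :=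
  indLiftApp_indMk k F hN ψ x y m g

/-- The natural transformation `M ⟶ N ∘ F`, `m ↦ φ(m ⊗ 1)`, corresponding to `φ : F^*(M) ⟶ N`. -/
def indUnlift {M : Cᵒᵖ ⥤ ModuleCat.{u} k} {N : Dᵒᵖ ⥤ ModuleCat.{u} k} (φ : indObj k F M ⟶ N) :
    M ⟶ F.op ⋙ N where
  app X := ModuleCat.ofHom ((φ.app (op (F.obj X.unop))).hom ∘ₗ
    (indMk k F M X.unop (F.obj X.unop)).flip (𝟙 _))
  naturality X Y f := by
    ext m
    have h1 := indMk_balanced k F M f.unop (F.obj Y.unop) m (𝟙 _)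
    have h2 := indObj_map_indMk k F M X.unop (F.map f.unop) m (𝟙 _)
    have h3 := congrArg (fun q => q.hom (indMk k F M X.unop (F.obj X.unop) m (𝟙 _)))
      (φ.naturality (F.map f.unop).op)
    rw [Category.id_comp] at h1
    rw [Category.comp_id] at h2
    exact (congrArg (φ.app (op (F.obj Y.unop))).hom (h1.trans h2.symm)).trans h3

lemma indLift_indUnlift {M : Cᵒᵖ ⥤ ModuleCat.{u} k} {N : Dᵒᵖ ⥤ ModuleCat.{u} k}
    (hN : isModule k D N) (φ : indObj k F M ⟶ N) : indLift k F hN (indUnlift k F φ) = φ :=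
  NatTrans.ext (funext fun Y => indObj_hom_ext k F fun x m g => by
    have h2 := indObj_map_indMk k F M x g m (𝟙 _)
    rw [Category.comp_id] at h2
    have h3 := congrArg (fun q => q.hom (indMk k F M x (F.obj x) m (𝟙 _)))
      (φ.naturality g.op)
    exact (indLift_indMk k F hN _ x Y.unop m g).trans
      (h3.symm.trans (congrArg (φ.app Y).hom h2)))

lemma indUnlift_indLift {M : Cᵒᵖ ⥤ ModuleCat.{u} k} {N : Dᵒᵖ ⥤ ModuleCat.{u} k}
    (hN : isModule k D N) (ψ : M ⟶ F.op ⋙ N) : indUnlift k F (indLift k F hN ψ) = ψ := by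
  ext X m
  refine (indLift_indMk k F hN ψ X.unop _ m (𝟙 _)).trans ?_
  exact congrArg (fun q => q.hom ((ψ.app X).hom m)) (N.map_id _)

variable [Preadditive C] [Linear k C]

/-- `F^* : Mod C ⥤ Mod D`, `F^*(M)(y) = M ⊗_C D(y, F(-))`. -/
def ind : ModCat k C ⥤ ModCat k D where
  obj M := ⟨indObj k F M.obj, indObj_isModule k F M.obj⟩
  map α := ObjectProperty.homMk (indMap k F α.hom)
  map_id _ := ObjectProperty.hom_ext _ (NatTrans.ext (funext fun Y =>
    indObj_hom_ext k F fun x m g => (indMap_indMk k F _ x Y.unop m g).trans rfl))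
  map_comp α β := ObjectProperty.hom_ext _ (NatTrans.ext (funext fun Y =>
    indObj_hom_ext k F fun x m g => (indMap_indMk k F _ x Y.unop m g).trans
      ((congrArg ((indMap k F β.hom).app Y).hom (indMap_indMk k F α.hom x Y.unop m g)).trans
        (indMap_indMk k F β.hom x Y.unop _ g)).symm))

variable [F.Additive] [F.Linear k]

/-- `F_* : Mod D ⥤ Mod C`, `M ↦ M ∘ F`. -/
def restr : ModCat k D ⥤ ModCat k C where
  obj M := ⟨F.op ⋙ M.obj, by
    obtain ⟨h1, h2⟩ := M.property
    refine ⟨inferInstance, ⟨fun f r => ?_⟩⟩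
    exact (congrArg (fun q => M.obj.map q.op) (F.map_smul r f.unop)).trans
      (h2.map_smul (F.map f.unop).op r)⟩
  map f := ObjectProperty.homMk (Functor.whiskerLeft F.op f.hom)

/-- `F^! : Mod C ⥤ Mod D`, `F^!(M)(y) = Hom_C(D(F(-), y), M)`. -/
def coind : ModCat k C ⥤ ModCat k D :=
  (isModule k D).lift
    (linearYoneda k (ModCat k C) ⋙
      (Functor.whiskeringLeft _ _ _).obj (yonedaMod k D ⋙ restr k F).op) fun M => by
    refine ⟨⟨fun {X Y f g} => ?_⟩, ⟨fun {X Y} f r => ?_⟩⟩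
    · ext (φ : (restr k F).obj ((yonedaMod k D).obj X.unop) ⟶ M)
      refine ObjectProperty.hom_ext _ ?_
      ext Z (h : F.obj Z.unop ⟶ Y.unop)
      refine (congrArg (φ.hom.app Z).hom (Preadditive.comp_add _ _ _ h f.unop g.unop)).trans ?_
      exact map_add _ _ _
    · ext (φ : (restr k F).obj ((yonedaMod k D).obj X.unop) ⟶ M)
      refine ObjectProperty.hom_ext _ ?_
      ext Z (h : F.obj Z.unop ⟶ Y.unop)
      refine (congrArg (φ.hom.app Z).hom (Linear.comp_smul _ _ _ h r f.unop)).trans ?_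
      exact map_smul _ _ _

/-- The adjunction `(F^*, F_*)`: a map `φ : F^*(M) ⟶ N` corresponds to `m ↦ φ(m ⊗ 1)`. -/
def indAdj : ind k F ⊣ restr k F :=
  Adjunction.mkOfHomEquiv
    { homEquiv := fun _ N =>
        { toFun := fun φ => ObjectProperty.homMk (indUnlift k F φ.hom)
          invFun := fun ψ => ObjectProperty.homMk (indLift k F N.property ψ.hom)
          left_inv := fun φ => ObjectProperty.hom_ext _ (indLift_indUnlift k F N.property φ.hom)
          right_inv := fun ψ => ObjectProperty.hom_ext _ (indUnlift_indLift k F N.property ψ.hom) }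
      homEquiv_naturality_left_symm := fun {_ _ N} α ψ =>
        ObjectProperty.hom_ext _ (NatTrans.ext (funext fun Y =>
          indObj_hom_ext k F fun x m g =>
            (indLift_indMk k F N.property (α.hom ≫ ψ.hom) x Y.unop m g).trans
              ((congrArg ((indLift k F N.property ψ.hom).app Y).hom
                (indMap_indMk k F α.hom x Y.unop m g)).trans
                (indLift_indMk k F N.property ψ.hom x Y.unop _ g)).symm))
      homEquiv_naturality_right := fun _ _ => rfl }

/-- The map `C(-, y) ⟶ N`, `g ↦ N(g)(n)`, given by `n ∈ N(y)`. -/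
def yonedaHom (N : ModCat k D) (y : D) : N.obj.obj (op y) →ₗ[k] ((yonedaMod k D).obj y ⟶ N) where
  toFun n := ObjectProperty.homMk
    { app := fun X => ModuleCat.ofHom
        (X := (X.unop ⟶ y))
        { toFun := fun g => (N.obj.map g.op).hom n
          map_add' := fun g g' => by
            have := N.property.1
            exact congrArg (fun q => q.hom n) (N.obj.map_add (f := g.op) (g := g'.op))
          map_smul' := fun r g => congrArg (fun q => q.hom n) (N.property.2.map_smul g.op r) }
      naturality := fun X Y f => by
        ext (g : X.unop ⟶ y)
        exact congrArg (fun q => q.hom n) (N.obj.map_comp g.op f) }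
  map_add' n n' := ObjectProperty.hom_ext _ (NatTrans.ext (funext fun X => by
    ext (g : X.unop ⟶ y)
    exact map_add (N.obj.map g.op).hom n n'))
  map_smul' r n := ObjectProperty.hom_ext _ (NatTrans.ext (funext fun X => by
    ext (g : X.unop ⟶ y)
    exact map_smul (N.obj.map g.op).hom r n))

lemma yonedaHom_map (N : ModCat k D) {y y' : D} (h : y' ⟶ y) (n : N.obj.obj (op y)) :
    yonedaHom k N y' ((N.obj.map h.op).hom n) = (yonedaMod k D).map h ≫ yonedaHom k N y n :=
  ObjectProperty.hom_ext _ (NatTrans.ext (funext fun X => by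
    ext (g : X.unop ⟶ y')
    exact congrArg (fun q => q.hom n) (N.obj.map_comp h.op g.op).symm))

/-- The value `α(1) ∈ M(x)` of a map `α : D(F(-), F(x)) ⟶ M`. -/
def coindEval (M : ModCat k C) (x : C) :
    ((restr k F).obj ((yonedaMod k D).obj (F.obj x)) ⟶ M) →ₗ[k] M.obj.obj (op x) where
  toFun α := (α.hom.app (op x)).hom (show F.obj x ⟶ F.obj x from 𝟙 _)
  map_add' _ _ := rfl
  map_smul' _ _ := rfl

/-- The map `F_*(N) ⟶ M` corresponding to `ψ : N ⟶ F^!(M)`. -/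
def coindUnlift {N : ModCat k D} {M : ModCat k C} (ψ : N ⟶ (coind k F).obj M) :
    (restr k F).obj N ⟶ M :=
  ObjectProperty.homMk
    { app := fun X => ModuleCat.ofHom
        (coindEval k F M X.unop ∘ₗ (ψ.hom.app (op (F.obj X.unop))).hom)
      naturality := fun X Y f => by
        ext (n : N.obj.obj (op (F.obj X.unop)))
        have h1 := congrArg (fun q => coindEval k F M Y.unop (q.hom n))
          (ψ.hom.naturality (F.map f.unop).op)
        let α : (restr k F).obj ((yonedaMod k D).obj (F.obj X.unop)) ⟶ M :=
          (ψ.hom.app (op (F.obj X.unop))).hom n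
        have h2 := congrArg (fun q => q.hom (show F.obj X.unop ⟶ F.obj X.unop from 𝟙 _))
          (α.hom.naturality f)
        refine h1.trans (Eq.trans ?_ h2)
        refine congrArg (α.hom.app Y).hom ?_
        exact (Category.id_comp (F.map f.unop)).trans (Category.comp_id (F.map f.unop)).symm }

/-- The map `N ⟶ F^!(M)` corresponding to `φ : F_*(N) ⟶ M`. -/
def coindLift {N : ModCat k D} {M : ModCat k C} (φ : (restr k F).obj N ⟶ M) :
    N ⟶ (coind k F).obj M :=
  ObjectProperty.homMk
    { app := fun Y => ModuleCat.ofHom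
        (Y := ((restr k F).obj ((yonedaMod k D).obj Y.unop) ⟶ M))
        { toFun := fun n => (restr k F).map (yonedaHom k N Y.unop n) ≫ φ
          map_add' := fun n n' => by
            rw [map_add]
            exact Preadditive.add_comp _ _ _ ((restr k F).map (yonedaHom k N Y.unop n))
              ((restr k F).map (yonedaHom k N Y.unop n')) φ
          map_smul' := fun r n => by
            rw [map_smul]
            exact Linear.smul_comp _ _ _ r ((restr k F).map (yonedaHom k N Y.unop n)) φ }
      naturality := fun Y Y' f => by
        ext n
        exact (congrArg (fun q => (restr k F).map q ≫ φ) (yonedaHom_map k N f.unop n)) }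

lemma coindUnlift_coindLift {N : ModCat k D} {M : ModCat k C} (φ : (restr k F).obj N ⟶ M) :
    coindUnlift k F (coindLift k F φ) = φ :=
  ObjectProperty.hom_ext _ (NatTrans.ext (funext fun X => by
    ext (n : N.obj.obj (op (F.obj X.unop)))
    exact congrArg (fun q => (φ.hom.app X).hom (q.hom n)) (N.obj.map_id _)))

lemma coindLift_coindUnlift {N : ModCat k D} {M : ModCat k C} (ψ : N ⟶ (coind k F).obj M) :
    coindLift k F (coindUnlift k F ψ) = ψ :=
  ObjectProperty.hom_ext _ (NatTrans.ext (funext fun Y => by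
    ext (n : N.obj.obj (op Y.unop))
    refine ObjectProperty.hom_ext _ (NatTrans.ext (funext fun X => ?_))
    ext (g : F.obj X.unop ⟶ Y.unop)
    let α : (restr k F).obj ((yonedaMod k D).obj Y.unop) ⟶ M := (ψ.hom.app Y).hom n
    refine (congrArg (fun q => coindEval k F M X.unop (q.hom n)) (ψ.hom.naturality g.op)).trans ?_
    exact congrArg (α.hom.app X).hom (Category.id_comp g)))

/-- The adjunction `(F_*, F^!)`: a map `φ : F_*(N) ⟶ M` corresponds to the map sending `n ∈ N(y)` to
`D(F(-), y) ⟶ M`, `g ↦ φ(N(g)(n))`. -/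
def coindAdj : restr k F ⊣ coind k F :=
  Adjunction.mkOfHomEquiv
    { homEquiv := fun _ _ =>
        { toFun := coindLift k F
          invFun := coindUnlift k F
          left_inv := coindUnlift_coindLift k F
          right_inv := coindLift_coindUnlift k F }
      homEquiv_naturality_left_symm := fun _ _ => rfl
      homEquiv_naturality_right := fun _ _ => rfl }

/-- `F` is coherent preserving: `F_*` and `F^!` preserve finitely presented modules. -/
structure IsCoherentPreserving : Prop where
  restr_mem : ∀ M : FPModCat k D, isFP k C ((restr k F).obj M.obj)
  coind_mem : ∀ M : FPModCat k C, isFP k D ((coind k F).obj M.obj)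

/-- The restriction `F_* : mod D ⥤ mod C` for a coherent preserving functor `F`. -/
def fpRestr {F : C ⥤ D} [F.Additive] [F.Linear k] (h : IsCoherentPreserving k F) :
    FPModCat k D ⥤ FPModCat k C :=
  (isFP k C).lift ((isFP k D).ι ⋙ restr k F) h.restr_mem

/-- The restriction `F^! : mod C ⥤ mod D` for a coherent preserving functor `F`. -/
def fpCoind {F : C ⥤ D} [F.Additive] [F.Linear k] (h : IsCoherentPreserving k F) :
    FPModCat k C ⥤ FPModCat k D :=
  (isFP k D).lift ((isFP k C).ι ⋙ coind k F) h.coind_mem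

/-- The restriction `F^* : mod C ⥤ mod D`. -/
def fpInd {F : C ⥤ D} (h : ∀ M : FPModCat k C, isFP k D ((ind k F).obj M.obj)) :
    FPModCat k C ⥤ FPModCat k D :=
  (isFP k D).lift ((isFP k C).ι ⋙ ind k F) h

/-- The adjunction `(F^*, F_*)` restricted to finitely presented modules. -/
def fpIndAdj {F : C ⥤ D} [F.Additive] [F.Linear k]
    (h : ∀ M : FPModCat k C, isFP k D ((ind k F).obj M.obj)) (h' : IsCoherentPreserving k F) :
    fpInd k h ⊣ fpRestr k h' :=
  (indAdj k F).restrictFullyFaithful (isFP k C).fullyFaithfulι (isFP k D).fullyFaithfulι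
    (Iso.refl _) (Iso.refl _)

/-- The adjunction `(F_*, F^!)` restricted to finitely presented modules. -/
def fpCoindAdj {F : C ⥤ D} [F.Additive] [F.Linear k] (h : IsCoherentPreserving k F) :
    fpRestr k h ⊣ fpCoind k h :=
  (coindAdj k F).restrictFullyFaithful (isFP k D).fullyFaithfulι (isFP k C).fullyFaithfulι
    (Iso.refl _) (Iso.refl _)

end Induced

/-! ### Inverse systems of categories, sources, the concrete inverse limit and the firm source -/

/-- An inverse system of categories `(C_i, F_ij, θ_ijk)` over `I`. -/
structure InverseSystem (I : Type u) [Preorder I] (C : I → Type w) [∀ i, Category.{v} (C i)] where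
  F : ∀ {i j : I}, i < j → (C j ⥤ C i)
  θ : ∀ {i j k : I} (hij : i < j) (hjk : j < k), F hjk ⋙ F hij ≅ F (hij.trans hjk)
  comm : ∀ {i j k l : I} (hij : i < j) (hjk : j < k) (hkl : k < l) (x : C l),
    (F hij).map ((θ hjk hkl).hom.app x) ≫ (θ hij (hjk.trans hkl)).hom.app x =
      (θ hij hjk).hom.app ((F hkl).obj x) ≫ (θ (hij.trans hjk) hkl).hom.app x

namespace InverseSystem

variable {I : Type u} [Preorder I] {C : I → Type w} [∀ i, Category.{v} (C i)]

/-- A source `(E, Φ_i, Θ_ij)` of an inverse system. -/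
structure Source (S : InverseSystem I C) (E : Type w') [Category.{v'} E] where
  Φ : ∀ i, E ⥤ C i
  Θ : ∀ {i j : I} (h : i < j), Φ j ⋙ S.F h ≅ Φ i
  comm : ∀ {i j k : I} (hij : i < j) (hjk : j < k) (x : E),
    (S.F hij).map ((Θ hjk).hom.app x) ≫ (Θ hij).hom.app x =
      (S.θ hij hjk).hom.app ((Φ k).obj x) ≫ (Θ (hij.trans hjk)).hom.app x

lemma comm_inv (S : InverseSystem I C) {i j k l : I} (hij : i < j) (hjk : j < k) (hkl : k < l)
    (x : C l) :
    (S.θ (hij.trans hjk) hkl).inv.app x ≫ (S.θ hij hjk).inv.app ((S.F hkl).obj x) =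
      (S.θ hij (hjk.trans hkl)).inv.app x ≫ (S.F hij).map ((S.θ hjk hkl).inv.app x) := by
  have h := S.comm hij hjk hkl x
  rw [← cancel_mono ((S.θ hij hjk).hom.app ((S.F hkl).obj x) ≫
    (S.θ (hij.trans hjk) hkl).hom.app x), ← h]
  simp only [Category.assoc, ← Functor.map_comp_assoc, Iso.inv_hom_id_app,
    CategoryTheory.Functor.map_id]
  rw [h]
  simp

lemma Source.comm_inv {S : InverseSystem I C} {E : Type w'} [Category.{v'} E] (T : S.Source E)
    {i j k : I} (hij : i < j) (hjk : j < k) (x : E) :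
    (T.Θ (hij.trans hjk)).inv.app x ≫ (S.θ hij hjk).inv.app ((T.Φ k).obj x) =
      (T.Θ hij).inv.app x ≫ (S.F hij).map ((T.Θ hjk).inv.app x) := by
  have h := T.comm hij hjk x
  rw [← cancel_mono ((S.θ hij hjk).hom.app ((T.Φ k).obj x) ≫
    (T.Θ (hij.trans hjk)).hom.app x), ← h]
  simp only [Category.assoc, ← Functor.map_comp_assoc, Iso.inv_hom_id_app,
    CategoryTheory.Functor.map_id]
  rw [h]
  simp

/-- Objects `(x_i, f_ij)` of the concrete inverse limit. -/
structure Limit (S : InverseSystem I C) where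
  obj : ∀ i, C i
  iso : ∀ {i j : I} (h : i < j), (S.F h).obj (obj j) ≅ obj i
  comm : ∀ {i j k : I} (hij : i < j) (hjk : j < k),
    (S.F hij).map (iso hjk).hom ≫ (iso hij).hom =
      (S.θ hij hjk).hom.app (obj k) ≫ (iso (hij.trans hjk)).hom

namespace Limit

variable {S : InverseSystem I C}

/-- Morphisms `(s_i)` of the concrete inverse limit. -/
@[ext]
structure Hom (x y : S.Limit) where
  app : ∀ i, x.obj i ⟶ y.obj i
  comm : ∀ {i j : I} (h : i < j),
    (x.iso h).hom ≫ app i = (S.F h).map (app j) ≫ (y.iso h).hom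

/-- The concrete inverse limit category, with componentwise composition. -/
instance : Category S.Limit where
  Hom x y := Hom x y
  id x := { app := fun i => 𝟙 (x.obj i), comm := fun h => by simp }
  comp s r :=
    { app := fun i => s.app i ≫ r.app i
      comm := fun h => by
        rw [← Category.assoc, s.comm, Category.assoc, r.comm, Functor.map_comp, Category.assoc] }
  id_comp _ := Hom.ext (funext fun _ => Category.id_comp _)
  comp_id _ := Hom.ext (funext fun _ => Category.comp_id _)
  assoc _ _ _ := Hom.ext (funext fun _ => Category.assoc _ _ _)

section Preadditive

variable [∀ i, Preadditive (C i)] [∀ (i j : I) (h : i < j), (S.F h).Additive] (x y : S.Limit)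

/-- The additive subgroup of compatible families in the product of the Hom-groups. -/
def homSubgroup : AddSubgroup (∀ i, x.obj i ⟶ y.obj i) where
  carrier := {s | ∀ (i j : I) (h : i < j),
    (x.iso h).hom ≫ s i = (S.F h).map (s j) ≫ (y.iso h).hom}
  zero_mem' i j h := by simp
  add_mem' {s r} hs hr i j h := by simp [hs i j h, hr i j h]
  neg_mem' {s} hs i j h := by simp [hs i j h]

/-- Morphisms are compatible families. -/
def homEquiv : (x ⟶ y) ≃ homSubgroup x y where
  toFun s := ⟨s.app, fun _ _ h => s.comm h⟩
  invFun s := ⟨s.1, fun h => s.2 _ _ h⟩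
  left_inv _ := rfl
  right_inv _ := rfl

/-- The componentwise preadditive structure. -/
instance : Preadditive S.Limit where
  homGroup x y := (homEquiv x y).addCommGroup
  add_comp _ _ _ _ _ _ := Hom.ext (funext fun _ => Preadditive.add_comp _ _ _ _ _ _)
  comp_add _ _ _ _ _ _ := Hom.ext (funext fun _ => Preadditive.comp_add _ _ _ _ _ _)

variable (k : Type uR) [Ring k] [∀ i, Linear k (C i)]
  [∀ (i j : I) (h : i < j), (S.F h).Linear k]

/-- The componentwise `k`-linear structure. -/
instance : Linear k S.Limit where
  homModule x y :=
    { smul := fun r s => ⟨fun i => r • s.app i, fun h => by simp [s.comm h]⟩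
      one_smul := fun _ => Hom.ext (funext fun _ => one_smul _ _)
      mul_smul := fun _ _ _ => Hom.ext (funext fun _ => mul_smul _ _ _)
      smul_zero := fun _ => Hom.ext (funext fun _ => smul_zero _)
      smul_add := fun _ _ _ => Hom.ext (funext fun _ => smul_add _ _ _)
      add_smul := fun _ _ _ => Hom.ext (funext fun _ => add_smul _ _ _)
      zero_smul := fun _ => Hom.ext (funext fun _ => zero_smul _ _) }
  smul_comp _ _ _ _ _ _ := Hom.ext (funext fun _ => Linear.smul_comp _ _ _ _ _ _)
  comp_smul _ _ _ _ _ _ := Hom.ext (funext fun _ => Linear.comp_smul _ _ _ _ _ _)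

end Preadditive

end Limit

variable (S : InverseSystem I C)

/-- The concrete inverse limit, as a source. -/
def limitSource : S.Source S.Limit where
  Φ i := { obj := fun x => x.obj i, map := fun s => s.app i }
  Θ h := NatIso.ofComponents (fun x => x.iso h) (fun s => (s.comm h).symm)
  comm hij hjk x := x.comm hij hjk

/-- An object `x` of the concrete inverse limit is firm if there is `t` such that for all `u > t`
the functor `F_tu` is bijective on morphisms out of and into `Φ_u(x)`. -/
def isFirm : ObjectProperty S.Limit := fun x =>
  ∃ t : I, ∀ (u : I) (h : t < u),
    (∀ b : C u, Function.Bijective fun f : x.obj u ⟶ b => (S.F h).map f) ∧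
    (∀ a : C u, Function.Bijective fun f : a ⟶ x.obj u => (S.F h).map f)

/-- The full subcategory of firm objects. -/
abbrev Firm := S.isFirm.FullSubcategory

/-- The firm source: the restriction of the concrete inverse limit to the firm objects. -/
def firmSource : S.Source S.Firm where
  Φ i := S.isFirm.ι ⋙ S.limitSource.Φ i
  Θ h := Functor.isoWhiskerLeft S.isFirm.ι (S.limitSource.Θ h)
  comm hij hjk x := S.limitSource.comm hij hjk x.obj

section Linear

variable [∀ i, Preadditive (C i)] [∀ (i j : I) (h : i < j), (S.F h).Additive]

instance (i : I) : (S.limitSource.Φ i).Additive where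
  map_add := rfl

instance (i : I) : (S.firmSource.Φ i).Additive :=
  inferInstanceAs (S.isFirm.ι ⋙ S.limitSource.Φ i).Additive

variable (k : Type uR) [Ring k] [∀ i, Linear k (C i)]
  [∀ (i j : I) (h : i < j), (S.F h).Linear k]

instance (i : I) : (S.limitSource.Φ i).Linear k where
  map_smul _ _ := rfl

instance (i : I) : (S.firmSource.Φ i).Linear k where
  map_smul _ _ := rfl

end Linear

end InverseSystem

/-! ### Direct systems of categories and admissible targets -/

/-- A direct system of categories `(A_i, G_ij, ζ_ijk)` over `I`. -/
structure DirectSystem (I : Type u) [Preorder I] (A : I → Type w) [∀ i, Category.{v} (A i)] where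
  G : ∀ {i j : I}, i < j → (A i ⥤ A j)
  ζ : ∀ {i j k : I} (hij : i < j) (hjk : j < k), G hij ⋙ G hjk ≅ G (hij.trans hjk)
  comm : ∀ {i j k l : I} (hij : i < j) (hjk : j < k) (hkl : k < l) (x : A i),
    (G hkl).map ((ζ hij hjk).hom.app x) ≫ (ζ (hij.trans hjk) hkl).hom.app x =
      (ζ hjk hkl).hom.app ((G hij).obj x) ≫ (ζ hij (hjk.trans hkl)).hom.app x

/-- A target `(B, Ψ_i, Z_ij)` of a direct system. -/
structure DirectSystem.Target {I : Type u} [Preorder I] {A : I → Type w} [∀ i, Category.{v} (A i)]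
    (S : DirectSystem I A) (B : Type w') [Category.{v'} B] where
  Ψ : ∀ i, A i ⥤ B
  Z : ∀ {i j : I} (h : i < j), S.G h ⋙ Ψ j ≅ Ψ i
  comm : ∀ {i j k : I} (hij : i < j) (hjk : j < k) (x : A i),
    (Ψ k).map ((S.ζ hij hjk).hom.app x) ≫ (Z (hij.trans hjk)).hom.app x =
      (Z hjk).hom.app ((S.G hij).obj x) ≫ (Z hij).hom.app x

section Admissible

/-- A preadditive category is abelian. -/
structure IsAbelianCat (A : Type w) [Category.{v} A] [Preadditive A] : Prop where
  hasFiniteProducts : HasFiniteProducts A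
  hasKernels : HasKernels A
  hasCokernels : HasCokernels A
  isNormalMonoCategory : IsNormalMonoCategory A
  isNormalEpiCategory : IsNormalEpiCategory A

/-- The `Abelian` instance, extending the given preadditive structure. -/
@[reducible]
def IsAbelianCat.toAbelian {A : Type w} [Category.{v} A] [P : Preadditive A] (h : IsAbelianCat A) :
    Abelian A :=
  { P, h.isNormalMonoCategory, h.isNormalEpiCategory with
    has_finite_products := h.hasFiniteProducts
    has_kernels := h.hasKernels
    has_cokernels := h.hasCokernels }

/-- `Ext^n_A(x, y) ≅ Ext^n_B(x', y')` as `R`-modules, for `R`-linear abelian categories. -/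
def ExtIso (R : Type uR) [Ring R] {A : Type w} [Category.{v} A] [Preadditive A] [Linear R A]
    {B : Type w'} [Category.{v'} B] [Preadditive B] [Linear R B] (hA : IsAbelianCat A)
    (hB : IsAbelianCat B) (n : ℕ) (x y : A) (x' y' : B) : Prop :=
  letI := hA.toAbelian
  letI := hB.toAbelian
  haveI := HasExt.standard A
  haveI := HasExt.standard B
  Nonempty (Abelian.Ext.{max w v} x y n ≃ₗ[R] Abelian.Ext.{max w' v'} x' y' n)

/-- The target `T` of the direct system `S`, with the adjunctions `(L_i, Ψ_i)` and `(Ψ_i, K_i)`, is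
an admissible target. The first five fields express that `S` is a direct system of abelian
categories and fully faithful exact functors. The categories are linear over a base ring `R` and the
isomorphisms of `Ext`-groups are `R`-linear (for plain abelian categories, `R = ℤ`). -/
structure IsAdmissibleTarget (R : Type uR) [Ring R] {I : Type u} [Preorder I] {A : I → Type w}
    [∀ i, Category.{v} (A i)] [∀ i, Preadditive (A i)] [∀ i, Linear R (A i)]
    {S : DirectSystem I A} {B : Type w'} [Category.{v'} B] [Preadditive B] [Linear R B]
    (T : S.Target B) {L K : ∀ i, B ⥤ A i} (adjL : ∀ i, L i ⊣ T.Ψ i) (adjK : ∀ i, T.Ψ i ⊣ K i) :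
    Prop where
  abelian : ∀ i, IsAbelianCat (A i)
  full_G : ∀ {i j : I} (h : i < j), (S.G h).Full
  faithful_G : ∀ {i j : I} (h : i < j), (S.G h).Faithful
  preservesFiniteLimits_G : ∀ {i j : I} (h : i < j), PreservesFiniteLimits (S.G h)
  preservesFiniteColimits_G : ∀ {i j : I} (h : i < j), PreservesFiniteColimits (S.G h)
  abelian_target : IsAbelianCat B
  full : ∀ i, (T.Ψ i).Full
  faithful : ∀ i, (T.Ψ i).Faithful
  isIso_unit_counit : ∀ x : B, ∃ t : I, ∀ u : I, t < u →
    IsIso ((adjL u).unit.app x) ∧ IsIso ((adjK u).counit.app x)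
  ext_left : ∀ (x : B) (n : ℕ), 0 < n → ∃ t : I, ∀ u : I, t < u → ∀ (z : A u) (r : ℕ),
    0 < r → r < n →
      ExtIso R abelian_target (abelian u) r x ((T.Ψ u).obj z) ((L u).obj x) z
  ext_right : ∀ (y : B) (n : ℕ), 0 < n → ∃ t : I, ∀ u : I, t < u → ∀ (z : A u) (r : ℕ),
    0 < r → r < n →
      ExtIso R abelian_target (abelian u) r ((T.Ψ u).obj z) y z ((K u).obj y)

end Admissible

/-! ### The direct system of module categories and its target -/

section ModuleSystem

variable (k : Type u) [Field k]

/-- An isomorphism `η : G ∘ F ≅ H` induces an isomorphism `F_* ∘ G_* ≅ H_*`, whose component at `M`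
is `M(η⁻¹)`. -/
def fpRestrCompIso {C D E : Type u} [Category.{u} C] [Preadditive C] [Linear k C]
    [Category.{u} D] [Preadditive D] [Linear k D] [Category.{u} E] [Preadditive E] [Linear k E]
    {F : C ⥤ D} [F.Additive] [F.Linear k] {G : D ⥤ E} [G.Additive] [G.Linear k]
    {H : C ⥤ E} [H.Additive] [H.Linear k] (hF : IsCoherentPreserving k F)
    (hG : IsCoherentPreserving k G) (hH : IsCoherentPreserving k H) (η : F ⋙ G ≅ H) :
    fpRestr k hG ⋙ fpRestr k hF ≅ fpRestr k hH :=
  NatIso.ofComponents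
    (fun M => ObjectProperty.isoMk _ (ObjectProperty.isoMk _
      (Functor.isoWhiskerRight (NatIso.op η.symm) M.obj.obj)))
    (fun α => ObjectProperty.hom_ext _ (ObjectProperty.hom_ext _ (NatTrans.ext
      (funext fun X => (α.hom.hom.naturality (η.inv.app X.unop).op).symm))))

variable {I : Type u} [Preorder I] {C : I → Type u} [∀ i, Category.{u} (C i)]
  [∀ i, Preadditive (C i)] [∀ i, Linear k (C i)] {S : InverseSystem I C}
  [∀ (i j : I) (h : i < j), (S.F h).Additive] [∀ (i j : I) (h : i < j), (S.F h).Linear k]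

/-- The direct system `(mod C_i, F_ij*, θ_ijk*)`. -/
def modSystem (hF : ∀ (i j : I) (h : i < j), IsCoherentPreserving k (S.F h)) :
    DirectSystem I fun i => FPModCat k (C i) where
  G {i j} h := fpRestr k (hF i j h)
  ζ {i j l} hij hjl := fpRestrCompIso k (hF j l hjl) (hF i j hij) (hF i l _) (S.θ hij hjl)
  comm {i j l m} hij hjl hlm M := by
    refine ObjectProperty.hom_ext _ (ObjectProperty.hom_ext _ (NatTrans.ext (funext fun X => ?_)))
    refine (M.obj.obj.map_comp _ _).symm.trans (Eq.trans ?_ (M.obj.obj.map_comp _ _))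
    exact congrArg (fun q => M.obj.obj.map q.op) (S.comm_inv hij hjl hlm X.unop)

/-- The target `(mod E, Φ_i*, Θ_ij*)` given by a source `(E, Φ_i, Θ_ij)`. -/
def modTarget (hF : ∀ (i j : I) (h : i < j), IsCoherentPreserving k (S.F h))
    {E : Type u} [Category.{u} E] [Preadditive E] [Linear k E] (T : S.Source E)
    [∀ i, (T.Φ i).Additive] [∀ i, (T.Φ i).Linear k]
    (hΦ : ∀ i, IsCoherentPreserving k (T.Φ i)) :
    (modSystem k hF).Target (FPModCat k E) where
  Ψ i := fpRestr k (hΦ i)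
  Z {i j} h := fpRestrCompIso k (hΦ j) (hF i j h) (hΦ i) (T.Θ h)
  comm {i j l} hij hjl M := by
    refine ObjectProperty.hom_ext _ (ObjectProperty.hom_ext _ (NatTrans.ext (funext fun X => ?_)))
    refine (M.obj.obj.map_comp _ _).symm.trans (Eq.trans ?_ (M.obj.obj.map_comp _ _))
    exact congrArg (fun q => M.obj.obj.map q.op) (T.comm_inv hij hjl X.unop)

end ModuleSystem

end
end AdmTarget

/-! A dense and full `Φ_u` makes `Φ_{u*}` an exact, fully faithful embedding whose essential image
consists of the modules annihilated by the kernel of `Φ_u`. A finitely presented module over the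
firm source is generated by one element sitting at a firm object `x`, and firmness of `x` makes
`Φ_u` injective on morphisms into `x` for all large `u`; so every finitely presented module
eventually lies in the image of `Φ_{u*}`, which is condition (ii). Applied to the terms of a
projective presentation of the first argument, or of an injective presentation of the second one,
this gives (iii) and (iv) by dimension shifting; the injective presentations are the `k`-duals of
projective ones. -/

namespace AdmTarget

noncomputable section

section Cokernels

variable {A : Type w} [Category.{v} A] [Preadditive A]

/-- `p` is a cokernel of `f`, as a property of the pair of morphisms. -/
def IsCokernel {X Y Z : A} (f : X ⟶ Y) (p : Y ⟶ Z) : Prop :=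
  ∃ w : f ≫ p = 0, Nonempty (IsColimit (CokernelCofork.ofπ p w))

namespace IsCokernel

variable {X Y Z : A} {f : X ⟶ Y} {p : Y ⟶ Z}

lemma of_exists_desc [Epi p] (w : f ≫ p = 0)
    (h : ∀ {T : A} (g : Y ⟶ T), f ≫ g = 0 → ∃ l, p ≫ l = g) : IsCokernel f p :=
  ⟨w, ⟨CokernelCofork.IsColimit.ofπ' p w fun g hg => ⟨_, (h g hg).choose_spec⟩⟩⟩

lemma exists_desc (h : IsCokernel f p) {T : A} (g : Y ⟶ T) (hg : f ≫ g = 0) :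
    ∃ l, p ≫ l = g :=
  ⟨_, (CokernelCofork.IsColimit.desc' h.2.some g hg).2⟩

lemma epi (h : IsCokernel f p) : Epi p :=
  Cofork.IsColimit.epi h.2.some

lemma comp_iso (h : IsCokernel f p) {Z' : A} (e : Z ≅ Z') : IsCokernel f (p ≫ e.hom) :=
  ⟨by rw [← Category.assoc, h.1, zero_comp],
    ⟨h.2.some.ofIsoColimit (Cofork.ext e (by rfl))⟩⟩

lemma map (h : IsCokernel f p) {B : Type w'} [Category.{v'} B] [Preadditive B] (F : A ⥤ B)
    [F.PreservesZeroMorphisms] [PreservesColimit (parallelPair f 0) F] :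
    IsCokernel (F.map f) (F.map p) :=
  ⟨by rw [← F.map_comp, h.1, F.map_zero], ⟨CokernelCofork.mapIsColimit _ h.2.some F⟩⟩

lemma epi_comp (h : IsCokernel f p) {X' : A} (e : X' ⟶ X) [Epi e] : IsCokernel (e ≫ f) p :=
  have := h.epi
  .of_exists_desc (by rw [Category.assoc, h.1, comp_zero]) fun g hg =>
    h.exists_desc g (by rwa [← cancel_epi e, ← Category.assoc, comp_zero])

lemma comp_iso_iso_comp (h : IsCokernel f p) {Y' : A} (e : Y ≅ Y') :
    IsCokernel (f ≫ e.hom) (e.inv ≫ p) :=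
  have := h.epi
  .of_exists_desc (by simp [h.1]) fun g hg => by
    obtain ⟨l, hl⟩ := h.exists_desc (e.hom ≫ g) (by simpa using hg)
    exact ⟨l, by rw [Category.assoc, hl, e.inv_hom_id_assoc]⟩

lemma biprod_desc [HasBinaryBiproducts A] (hp : IsCokernel f p) {N N' L : A} {g : N ⟶ Z}
    {c : Z ⟶ L} (hc : IsCokernel g c) (q : N' ⟶ N) [Epi q] (s : N' ⟶ Y) (hs : s ≫ p = q ≫ g) :
    IsCokernel (biprod.desc f s) (p ≫ c) := by
  have := hp.epi
  have := hc.epi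
  refine of_exists_desc ?_ fun a ha => ?_
  · ext
    · simp [reassoc_of% hp.1]
    · simp [reassoc_of% hs, hc.1]
  · obtain ⟨b, rfl⟩ := hp.exists_desc a (by simpa using biprod.inl ≫= ha)
    obtain ⟨l, rfl⟩ := hc.exists_desc b (by
      rw [← cancel_epi q, ← reassoc_of% hs]
      simpa using biprod.inr ≫= ha)
    exact ⟨l, Category.assoc _ _ _⟩

lemma biprod_map [HasBinaryBiproducts A] (h : IsCokernel f p) {X' Y' Z' : A} {f' : X' ⟶ Y'}
    {p' : Y' ⟶ Z'} (h' : IsCokernel f' p') : IsCokernel (biprod.map f f') (biprod.map p p') := by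
  have := h.epi
  have := h'.epi
  refine of_exists_desc ?_ fun a ha => ?_
  · ext <;> simp [h.1, h'.1]
  · obtain ⟨l, hl⟩ := h.exists_desc (biprod.inl ≫ a) (by simpa using biprod.inl ≫= ha)
    obtain ⟨l', hl'⟩ := h'.exists_desc (biprod.inr ≫ a) (by simpa using biprod.inr ≫= ha)
    exact ⟨biprod.desc l l', by ext <;> simp [hl, hl']⟩

end IsCokernel

lemma isCokernel_zero_id (X Y : A) : IsCokernel (0 : X ⟶ Y) (𝟙 Y) :=
  .of_exists_desc zero_comp fun g _ => ⟨g, Category.id_comp g⟩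

lemma isCokernel_iff_exact_and_epi {A : Type w} [Category.{v} A] [Abelian A]
    (S : ShortComplex A) : IsCokernel S.f S.g ↔ S.Exact ∧ Epi S.g := by
  rw [S.exact_and_epi_g_iff_g_is_cokernel]
  exact ⟨fun h => h.2, fun h => ⟨S.zero, h⟩⟩

lemma isClosedUnderFiniteProducts_of_biprod [HasFiniteProducts A] [HasBinaryBiproducts A]
    (P : ObjectProperty A) [P.IsClosedUnderIsomorphisms] [P.ContainsZero]
    (h : ∀ X Y : A, P X → P Y → P (X ⊞ Y)) : P.IsClosedUnderFiniteProducts := by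
  have : P.IsClosedUnderBinaryProducts := by
    refine ⟨?_⟩
    rintro X ⟨p⟩
    have e : p.diag.obj ⟨.left⟩ ⊞ p.diag.obj ⟨.right⟩ ≅ X :=
      (BinaryBiproduct.isLimit _ _).conePointsIsoOfNatIso p.isLimit (diagramIsoPair p.diag).symm
    exact P.prop_of_iso e (h _ _ (p.prop_diag_obj _) (p.prop_diag_obj _))
  exact .mk'

lemma isAbelianCat_of_abelian {A : Type w} [Category.{v} A] [Abelian A] : IsAbelianCat A where
  hasFiniteProducts := inferInstance
  hasKernels := inferInstance
  hasCokernels := inferInstance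
  isNormalMonoCategory := inferInstance
  isNormalEpiCategory := inferInstance

end Cokernels

section ModuleCategory

variable (k : Type u) [Field k] (C : Type u) [Category.{u} C] [Preadditive C] [Linear k C]

instance : (isModule k C).IsClosedUnderSubobjects where
  prop_of_mono {K M} i _ := by
    rintro ⟨_, _⟩
    have (X : Cᵒᵖ) : Mono (i.app X) := inferInstance
    exact ⟨⟨fun {X Y f g} => by rw [← cancel_mono (i.app Y)]; simp [M.map_add]⟩,
      ⟨fun {X Y} f r => by rw [← cancel_mono (i.app Y)]; simp [M.map_smul]⟩⟩

instance : (isModule k C).IsClosedUnderQuotients where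
  prop_of_epi {M K} p _ := by
    rintro ⟨_, _⟩
    have (X : Cᵒᵖ) : Epi (p.app X) := inferInstance
    refine ⟨⟨fun {X Y f g} => ?_⟩, ⟨fun {X Y} f r => ?_⟩⟩
    · rw [← cancel_epi (p.app X)]
      simp only [← p.naturality, M.map_add, Preadditive.add_comp, Preadditive.comp_add]
    · rw [← cancel_epi (p.app X)]
      simp only [← p.naturality, M.map_smul, Linear.smul_comp, Linear.comp_smul]

instance : (isModule k C).ContainsZero where
  exists_zero := by
    obtain ⟨Z, hZ⟩ := HasZeroObject.zero (C := Cᵒᵖ ⥤ ModuleCat.{u} k)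
    exact ⟨Z, hZ, ⟨(hZ.obj _).eq_of_src _ _⟩, ⟨fun _ _ => (hZ.obj _).eq_of_src _ _⟩⟩

instance : (isModule k C).IsClosedUnderFiniteProducts where
  isClosedUnderLimitsOfShape J _ := ⟨by
    rintro M ⟨p⟩
    have (j : Discrete J) : (p.diag.obj j).Additive := (p.prop_diag_obj j).1
    have (j : Discrete J) : (p.diag.obj j).Linear k := (p.prop_diag_obj j).2
    have hom_ext {X Y : Cᵒᵖ} {f g : M.obj X ⟶ M.obj Y}
        (h : ∀ j, f ≫ (p.π.app j).app Y = g ≫ (p.π.app j).app Y) : f = g :=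
      (isLimitOfPreserves ((evaluation _ _).obj Y) p.isLimit).hom_ext h
    refine ⟨⟨fun {X Y f g} => hom_ext fun j => ?_⟩, ⟨fun {X Y} f r => hom_ext fun j => ?_⟩⟩
    · simp only [NatTrans.naturality, Functor.map_add, Preadditive.add_comp, Preadditive.comp_add]
    · simp only [NatTrans.naturality, Functor.map_smul, Linear.smul_comp, Linear.comp_smul]⟩

instance : PreservesFiniteLimits (isModule k C).ι :=
  have := (isModule k C).preservesKernels_ι
  Functor.preservesFiniteLimits_of_preservesKernels _

instance : PreservesFiniteColimits (isModule k C).ι :=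
  have := (isModule k C).preservesCokernels_ι
  Functor.preservesFiniteColimits_of_preservesCokernels _

variable {k C}

namespace ModCat

lemma naturality_apply {M N : ModCat k C} (α : M ⟶ N) {x y : C} (f : x ⟶ y)
    (m : M.obj.obj (op y)) :
    (α.hom.app (op x)).hom ((M.obj.map f.op).hom m) =
      (N.obj.map f.op).hom ((α.hom.app (op y)).hom m) :=
  congr($(α.hom.naturality f.op).hom m)

lemma mono_iff_injective_app {M N : ModCat k C} (f : M ⟶ N) :
    Mono f ↔ ∀ c, Function.Injective (f.hom.app c).hom := by
  simp_rw [← (isModule k C).ι.mono_map_iff_mono, NatTrans.mono_iff_mono_app,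
    ModuleCat.mono_iff_injective]
  rfl

lemma epi_iff_surjective_app {M N : ModCat k C} (f : M ⟶ N) :
    Epi f ↔ ∀ c, Function.Surjective (f.hom.app c).hom := by
  simp_rw [← (isModule k C).ι.epi_map_iff_epi, NatTrans.epi_iff_epi_app,
    ModuleCat.epi_iff_surjective]
  rfl

lemma exact_iff_exact_app (S : ShortComplex (ModCat k C)) :
    S.Exact ↔ ∀ c, Function.Exact (S.f.hom.app c).hom (S.g.hom.app c).hom := by
  have exact_eval (c : Cᵒᵖ) : ((S.map (isModule k C).ι).map ((evaluation _ _).obj c)).Exact ↔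
      Function.Exact (S.f.hom.app c).hom (S.g.hom.app c).hom :=
    ShortComplex.ShortExact.moduleCat_exact_iff_function_exact _
  simp_rw [← S.exact_map_iff_of_faithful (isModule k C).ι, ← exact_eval,
    ShortComplex.exact_iff_isZero_homology, Functor.isZero_iff]
  exact forall_congr' fun c =>
    ((S.map (isModule k C).ι).mapHomologyIso ((evaluation _ _).obj c)).isZero_iff.symm

end ModCat

end ModuleCategory

section Yoneda

variable {k : Type u} [Field k] {C : Type u} [Category.{u} C] [Preadditive C] [Linear k C]

instance : (yonedaMod k C).Additive where
  map_add {x y f g} := by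
    refine ObjectProperty.hom_ext _ (NatTrans.ext (funext fun c => ?_))
    ext (h : c.unop ⟶ x)
    exact Preadditive.comp_add _ _ _ h f g

variable (k) in
/-- The Yoneda lemma for modules: a map `C(-, x) ⟶ M` is evaluated at `1 ∈ C(x, x)`; the inverse
is `yonedaHom`. -/
def yonedaModEquiv (x : C) (M : ModCat k C) :
    ((yonedaMod k C).obj x ⟶ M) ≃ M.obj.obj (op x) where
  toFun p := (p.hom.app (op x)).hom (show x ⟶ x from 𝟙 x)
  invFun := yonedaHom k M x
  left_inv p := by
    refine ObjectProperty.hom_ext _ (NatTrans.ext (funext fun c => ?_))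
    ext (h : c.unop ⟶ x)
    exact (ModCat.naturality_apply p h (show x ⟶ x from 𝟙 x)).symm.trans
      congr((p.hom.app c).hom $(Category.comp_id h))
  right_inv m := congr($(M.obj.map_id (op x)).hom m)

lemma yonedaModEquiv_comp {x : C} {M N : ModCat k C} (p : (yonedaMod k C).obj x ⟶ M) (f : M ⟶ N) :
    yonedaModEquiv k x N (p ≫ f) = (f.hom.app (op x)).hom (yonedaModEquiv k x M p) :=
  rfl

instance (x : C) : Projective ((yonedaMod k C).obj x) where
  factors {M N} f e _ := by
    obtain ⟨m, hm⟩ := (ModCat.epi_iff_surjective_app e).1 inferInstance _ (yonedaModEquiv k x _ f)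
    refine ⟨(yonedaModEquiv k x M).symm m, (yonedaModEquiv k x N).injective ?_⟩
    rw [yonedaModEquiv_comp, Equiv.apply_symm_apply, hm]

end Yoneda

section FinitelyPresented

variable {k : Type u} [Field k] {C : Type u} [Category.{u} C] [Preadditive C] [Linear k C]

lemma isFP_iff_exists_isCokernel {M : ModCat k C} :
    isFP k C M ↔ ∃ (x y : C) (f : (yonedaMod k C).obj y ⟶ (yonedaMod k C).obj x)
      (p : (yonedaMod k C).obj x ⟶ M), IsCokernel f p := by
  refine exists₄_congr fun x y f p => ⟨fun h => ?_, fun h c => ?_⟩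
  · have w : f ≫ p = 0 := ObjectProperty.hom_ext _ (NatTrans.ext (funext fun c =>
      ModuleCat.hom_ext (h c).1.linearMap_comp_eq_zero))
    exact (isCokernel_iff_exact_and_epi (.mk f p w)).2
      ⟨(ModCat.exact_iff_exact_app _).2 fun c => (h c).1,
        (ModCat.epi_iff_surjective_app p).2 fun c => (h c).2⟩
  · have ⟨exact, epi⟩ := (isCokernel_iff_exact_and_epi (.mk f p h.1)).1 h
    exact ⟨(ModCat.exact_iff_exact_app _).1 exact c, (ModCat.epi_iff_surjective_app p).1 epi c⟩

lemma isFP_yonedaMod (x : C) : isFP k C ((yonedaMod k C).obj x) :=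
  isFP_iff_exists_isCokernel.2 ⟨x, x, 0, 𝟙 _, isCokernel_zero_id _ _⟩

instance : (isFP k C).IsClosedUnderIsomorphisms where
  of_iso e h := by
    obtain ⟨x, y, f, p, hp⟩ := isFP_iff_exists_isCokernel.1 h
    exact isFP_iff_exists_isCokernel.2 ⟨x, y, f, p ≫ e.hom, hp.comp_iso e⟩

variable [HasFiniteBiproducts C]

lemma isFP_biprod_yonedaMod (x y : C) :
    isFP k C ((yonedaMod k C).obj x ⊞ (yonedaMod k C).obj y) :=
  have := hasBinaryBiproducts_of_finite_biproducts C
  have := preservesBinaryBiproducts_of_preservesBiproducts (yonedaMod k C)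
  (isFP k C).prop_of_iso ((yonedaMod k C).mapBiprod x y) (isFP_yonedaMod (x ⊞ y))

lemma isFP_of_isCokernel {N M L : ModCat k C} {g : N ⟶ M} {c : M ⟶ L} (hc : IsCokernel g c)
    (hN : isFP k C N) (hM : isFP k C M) : isFP k C L := by
  have := hasBinaryBiproducts_of_finite_biproducts C
  have := preservesBinaryBiproducts_of_preservesBiproducts (yonedaMod k C)
  obtain ⟨x', y', f', q, hq⟩ := isFP_iff_exists_isCokernel.1 hN
  obtain ⟨x, y, f, p, hp⟩ := isFP_iff_exists_isCokernel.1 hM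
  have := hq.epi
  have := hp.epi
  let e := (yonedaMod k C).mapBiprod y x'
  have h : IsCokernel _ (p ≫ c) :=
    hp.biprod_desc hc q (Projective.factorThru (q ≫ g) p) (Projective.factorThru_comp _ _)
  exact isFP_iff_exists_isCokernel.2 ⟨x, y ⊞ x', _, p ≫ c, h.epi_comp e.hom⟩

instance : (isFP k C).IsClosedUnderCokernels where
  cokernels_le := by
    rintro _ ⟨f, c, hc, hM, hN⟩
    exact isFP_of_isCokernel ⟨c.condition, ⟨hc.ofIsoColimit (Cofork.isoCoforkOfπ c)⟩⟩ hM hN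

instance : (isFP k C).ContainsZero where
  exists_zero := ⟨_, (yonedaMod k C).map_isZero (isZero_zero C), isFP_yonedaMod _⟩

instance : (isFP k C).IsClosedUnderFiniteProducts :=
  isClosedUnderFiniteProducts_of_biprod _ fun M N hM hN => by
    obtain ⟨_, _, _, _, hp⟩ := isFP_iff_exists_isCokernel.1 hM
    obtain ⟨_, _, _, _, hq⟩ := isFP_iff_exists_isCokernel.1 hN
    exact isFP_of_isCokernel (hp.biprod_map hq) (isFP_biprod_yonedaMod _ _)
      (isFP_biprod_yonedaMod _ _)

end FinitelyPresented

section FullEssSurj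

open Functor

variable {C D E : Type*} [Category* C] [Category* D] [Category* E]
  (L : C ⥤ D) [L.EssSurj]

lemma faithful_whiskeringLeft : ((whiskeringLeft C D E).obj L).Faithful where
  map_injective {M N α β} h := NatTrans.ext <| funext fun d => by
    rw [← cancel_epi (M.map (L.objObjPreimageIso d).hom), α.naturality, β.naturality]
    exact congr($(congr_app h (L.objPreimage d)) ≫ N.map (L.objObjPreimageIso d).hom)

variable [L.Full]

/-- A full and essentially surjective functor identifies its target with the quotient of its source
by the relation `L.map f = L.map g`. -/
abbrev quotientEquivalence : CategoryTheory.Quotient L.homRel ≌ D :=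
  (CategoryTheory.Quotient.lift L.homRel L fun _ _ _ _ h => h).asEquivalence

lemma full_whiskeringLeft : ((whiskeringLeft C D E).obj L).Full :=
  inferInstanceAs ((whiskeringLeft _ _ E).obj (quotientEquivalence L).functor ⋙
    (whiskeringLeft _ _ E).obj (CategoryTheory.Quotient.functor L.homRel)).Full

lemma exists_comp_iso_of_map_eq {M : C ⥤ E}
    (h : ∀ (x y : C) (f g : x ⟶ y), L.map f = L.map g → M.map f = M.map g) :
    ∃ N : D ⥤ E, Nonempty (L ⋙ N ≅ M) :=
  ⟨(quotientEquivalence L).inverse ⋙ CategoryTheory.Quotient.lift _ M h,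
    ⟨isoWhiskerLeft (CategoryTheory.Quotient.functor L.homRel)
      ((quotientEquivalence L).funInvIdAssoc (CategoryTheory.Quotient.lift _ M h))⟩⟩

end FullEssSurj

section InverseImage

variable {A : Type w} [Category.{v} A] [HasZeroMorphisms A] {B : Type w'} [Category.{v'} B]
  [HasZeroMorphisms B] (P : ObjectProperty B) (F : A ⥤ B) [F.PreservesZeroMorphisms]

lemma isClosedUnderKernels_inverseImage [P.IsClosedUnderKernels] [PreservesFiniteLimits F] :
    (P.inverseImage F).IsClosedUnderKernels where
  kernels_le := by
    rintro _ ⟨f, c, hc, hX, hY⟩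
    exact P.prop_of_isLimit_kernelFork (KernelFork.mapIsLimit c hc F) hX hY

lemma isClosedUnderCokernels_inverseImage [P.IsClosedUnderCokernels] [PreservesFiniteColimits F] :
    (P.inverseImage F).IsClosedUnderCokernels where
  cokernels_le := by
    rintro _ ⟨f, c, hc, hX, hY⟩
    exact P.prop_of_isColimit_cokernelCofork (CokernelCofork.mapIsColimit c hc F) hX hY

end InverseImage

section ChangeOfCategory

variable {k : Type u} [Field k] {C D : Type u} [Category.{u} C] [Preadditive C] [Linear k C]
  [Category.{u} D] [Preadditive D] [Linear k D] (F : C ⥤ D)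

/-- The module `M` is annihilated by the morphisms that `F` sends to zero, that is, by the ideal
`ker F` of `C`. -/
def AnnihilatedByKer (M : ModCat k C) : Prop :=
  ∀ ⦃x y : C⦄ (f : x ⟶ y), F.map f = 0 → M.obj.map f.op = 0

variable [F.Additive] [F.Linear k]

instance : F.op.Linear k where
  map_smul f r := congrArg Quiver.Hom.op (F.map_smul r f.unop)

instance : (restr k F).Additive where
  map_add := rfl

instance : PreservesLimits (restr k F) :=
  (indAdj k F).rightAdjoint_preservesLimits

instance : PreservesColimits (restr k F) :=
  (coindAdj k F).leftAdjoint_preservesColimits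

lemma full_restr [F.EssSurj] [F.Full] : (restr k F).Full :=
  have := full_whiskeringLeft (E := ModuleCat.{u} k) F.op
  .of_comp_faithful_iso (G := (isModule k C).ι)
    (Iso.refl ((isModule k D).ι ⋙ (Functor.whiskeringLeft _ _ _).obj F.op))

lemma faithful_restr [F.EssSurj] : (restr k F).Faithful :=
  have := faithful_whiskeringLeft (E := ModuleCat.{u} k) F.op
  .of_comp_iso (G := (isModule k C).ι)
    (Iso.refl ((isModule k D).ι ⋙ (Functor.whiskeringLeft _ _ _).obj F.op))

variable {F} in
lemma AnnihilatedByKer.mem_essImage_restr [F.EssSurj] [F.Full] {M : ModCat k C}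
    (hM : AnnihilatedByKer F M) : (restr k F).essImage M := by
  have := M.property.1
  have := M.property.2
  obtain ⟨N, ⟨e⟩⟩ := exists_comp_iso_of_map_eq F.op (M := M.obj) fun x y f g h => by
    rw [← sub_eq_zero, ← M.obj.map_sub]
    refine hM (f - g).unop ?_
    rw [unop_sub, F.map_sub, sub_eq_zero]
    exact Quiver.Hom.op_inj h
  have := Functor.additive_of_iso e.symm
  have := Functor.linear_of_iso k e.symm
  have hN : isModule k D N :=
    ⟨F.op.additive_of_full_essSurj_comp N, F.op.linear_of_full_essSurj_comp N⟩
  exact ⟨⟨N, hN⟩, ⟨(isModule k C).isoMk e⟩⟩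

/-- `F^*(C(-, x)) ≅ D(-, F(x))`: both corepresent `N ↦ N(F(x))`. -/
def indYonedaIso (x : C) :
    (ind k F).obj ((yonedaMod k C).obj x) ≅ (yonedaMod k D).obj (F.obj x) :=
  let evalAt : ModCat k D ⥤ Type u :=
    (isModule k D).ι ⋙ (evaluation _ _).obj (op (F.obj x)) ⋙ forget (ModuleCat k)
  Functor.CorepresentableBy.uniqueUpToIso (F := evalAt)
    { homEquiv {N} := ((indAdj k F).homEquiv _ N).trans (yonedaModEquiv k x ((restr k F).obj N))
      homEquiv_comp g f := congrArg (yonedaModEquiv k x _)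
        ((indAdj k F).homEquiv_naturality_right f g) }
    { homEquiv {N} := yonedaModEquiv k (F.obj x) N
      homEquiv_comp g f := yonedaModEquiv_comp f g }

lemma isFP_ind {M : ModCat k C} (hM : isFP k C M) : isFP k D ((ind k F).obj M) := by
  have := (indAdj k F).left_adjoint_additive
  have := (indAdj k F).leftAdjoint_preservesColimits
  obtain ⟨x, y, f, p, hp⟩ := isFP_iff_exists_isCokernel.1 hM
  have h := ((hp.map (ind k F)).comp_iso_iso_comp (indYonedaIso F x)).epi_comp
    (indYonedaIso F y).inv
  exact isFP_iff_exists_isCokernel.2 ⟨F.obj x, F.obj y, _, _, h⟩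

section FullEssSurj

variable [F.Full] [F.EssSurj]

lemma isFP_eq_inverseImage_restr (hF : ∀ M : FPModCat k D, isFP k C ((restr k F).obj M.obj)) :
    isFP k D = (isFP k C).inverseImage (restr k F) := by
  ext N
  have := full_restr (k := k) F
  have := faithful_restr (k := k) F
  exact ⟨fun hN => hF ⟨N, hN⟩, fun hN =>
    (isFP k D).prop_of_iso (asIso ((indAdj k F).counit.app N)) (isFP_ind F hN)⟩

lemma isAbelianCat_FPModCat_of_restr [HasFiniteBiproducts C] [(isFP k C).IsClosedUnderKernels]
    (hF : ∀ M : FPModCat k D, isFP k C ((restr k F).obj M.obj)) : IsAbelianCat (FPModCat k D) := by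
  have h := isFP_eq_inverseImage_restr F hF
  have : (isFP k D).ContainsZero := h ▸ inferInstance
  have : (isFP k D).IsClosedUnderKernels := h ▸ isClosedUnderKernels_inverseImage _ _
  have : (isFP k D).IsClosedUnderCokernels := h ▸ isClosedUnderCokernels_inverseImage _ _
  have : (isFP k D).IsClosedUnderFiniteProducts := h ▸ ⟨fun _ _ => inferInstance⟩
  exact isAbelianCat_of_abelian

end FullEssSurj

variable {F} (h : IsCoherentPreserving k F)

instance : (fpRestr k h).Additive where
  map_add := rfl

instance : (fpRestr k h).Linear k where
  map_smul _ _ := rfl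

variable [F.EssSurj]

instance : (fpRestr k h).Faithful :=
  have := faithful_restr (k := k) F
  .of_comp_iso (G := (isFP k C).ι) (Iso.refl ((isFP k D).ι ⋙ restr k F))

variable [F.Full]

instance : (fpRestr k h).Full :=
  have := full_restr (k := k) F
  .of_comp_faithful_iso (G := (isFP k C).ι) (Iso.refl ((isFP k D).ι ⋙ restr k F))

lemma AnnihilatedByKer.mem_essImage_fpRestr {M : FPModCat k C} (hM : AnnihilatedByKer F M.obj) :
    (fpRestr k h).essImage M := by
  obtain ⟨N, ⟨e⟩⟩ := hM.mem_essImage_restr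
  have hN : isFP k D N := by
    rw [isFP_eq_inverseImage_restr F h.restr_mem]
    exact (isFP k C).prop_of_iso e.symm M.property
  exact ⟨⟨N, hN⟩, ⟨(isFP k C).isoMk e⟩⟩

end ChangeOfCategory

section Projectives

variable (k : Type u) [Field k] (C : Type u) [Category.{u} C] [Preadditive C] [Linear k C]

lemma FPModCat.enoughProjectives [HasFiniteBiproducts C] : EnoughProjectives (FPModCat k C) where
  presentation M := by
    obtain ⟨x, y, f, p, hp⟩ := isFP_iff_exists_isCokernel.1 M.property
    have := (isFP k C).preservesEpimorphisms_ι_of_isNormalMonoCategory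
    let P : FPModCat k C := ⟨(yonedaMod k C).obj x, isFP_yonedaMod x⟩
    exact ⟨{
      p := P
      f := ObjectProperty.homMk p
      projective := (isFP k C).ι.projective_of_map_projective
        (inferInstanceAs (Projective ((yonedaMod k C).obj x)))
      epi := (isFP k C).ι.epi_of_epi_map hp.epi }⟩

end Projectives

section Duality

variable {k : Type u} [Field k] {C : Type u} [Category.{u} C] [Preadditive C] [Linear k C]

instance [HasFiniteBiproducts C] : HasFiniteBiproducts Cᵒᵖ :=
  .of_hasFiniteProducts

lemma exact_dualMap {U V W : Type*} [AddCommGroup U] [Module k U] [AddCommGroup V] [Module k V]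
    [AddCommGroup W] [Module k W] {f : U →ₗ[k] V} {g : V →ₗ[k] W} (h : Function.Exact f g) :
    Function.Exact g.dualMap f.dualMap := by
  rw [LinearMap.exact_iff] at h ⊢
  rw [LinearMap.range_dualMap_eq_dualAnnihilator_ker, h,
    LinearMap.ker_dualMap_eq_dualAnnihilator_range]

lemma isCokernel_modDual_map {M N K : ModCat k C} {i : K ⟶ M} {f : M ⟶ N} (w : i ≫ f = 0)
    (exact : (ShortComplex.mk i f w).Exact) [Mono i] :
    IsCokernel ((modDual k C).map f.op) ((modDual k C).map i.op) := by
  have hi := (ModCat.mono_iff_injective_app i).1 inferInstance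
  have hif := (ModCat.exact_iff_exact_app _).1 exact
  have w' : (modDual k C).map f.op ≫ (modDual k C).map i.op = 0 :=
    ObjectProperty.hom_ext _ (NatTrans.ext (funext fun c =>
      ModuleCat.hom_ext (exact_dualMap (hif c.unop)).linearMap_comp_eq_zero))
  exact (isCokernel_iff_exact_and_epi (.mk _ _ w')).2
    ⟨(ModCat.exact_iff_exact_app _).2 fun c => exact_dualMap (hif c.unop),
      (ModCat.epi_iff_surjective_app _).2 fun c =>
        LinearMap.dualMap_surjective_of_injective (hi c.unop)⟩

/-- The evaluation map `M ⟶ D (D M)`. -/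
def doubleDualHom (M : ModCat k C) : M ⟶ (modDualOp k C).obj (op ((modDual k C).obj (op M))) :=
  ObjectProperty.homMk
    { app X := ModuleCat.ofHom (Module.Dual.eval k (M.obj.obj X))
      naturality _ _ _ := rfl }

lemma isIso_doubleDualHom {M : ModCat k C} (hM : ∀ c, Module.Finite k (M.obj.obj c)) :
    IsIso (doubleDualHom M) := by
  have bijective (c : Cᵒᵖ) : Function.Bijective ((doubleDualHom M).hom.app c).hom :=
    have := hM c
    Module.bijective_dual_eval k (M.obj.obj c)
  have := (ModCat.mono_iff_injective_app (doubleDualHom M)).2 fun c => (bijective c).1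
  have := (ModCat.epi_iff_surjective_app (doubleDualHom M)).2 fun c => (bijective c).2
  exact isIso_of_mono_of_epi _

lemma finite_of_isFP (hC : ∀ x y : C, Module.Finite k (x ⟶ y)) {M : ModCat k C}
    (hM : isFP k C M) (c : Cᵒᵖ) : Module.Finite k (M.obj.obj c) := by
  obtain ⟨x, y, f, p, hp⟩ := hM
  have : Module.Finite k (((yonedaMod k C).obj x).obj.obj c) := hC c.unop x
  exact .of_surjective (p.hom.app c).hom (hp c).2

namespace IsDualizingVariety

variable (h : IsDualizingVariety k C)
include h

lemma isClosedUnderKernels : (isFP k C).IsClosedUnderKernels where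
  kernels_le := by
    rintro K ⟨f, c, hc, hM, hN⟩
    have := h.krullSchmidt.hasFiniteBiproducts
    have mono : Mono c.ι := Fork.IsLimit.mono hc
    have exact : (ShortComplex.mk c.ι f c.condition).Exact :=
      ShortComplex.exact_of_f_is_kernel _ (hc.ofIsoLimit (Fork.isoForkOfι c))
    have dual_fp : isFP k Cᵒᵖ ((modDual k C).obj (op c.pt)) :=
      isFP_of_isCokernel (isCokernel_modDual_map _ exact) (h.dual_mem ⟨_, hN⟩)
        (h.dual_mem ⟨_, hM⟩)
    have finite (x : Cᵒᵖ) : Module.Finite k (c.pt.obj.obj x) :=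
      have := finite_of_isFP h.homFinite hM x
      .of_injective (c.ι.hom.app x).hom ((ModCat.mono_iff_injective_app c.ι).1 mono x)
    have := isIso_doubleDualHom finite
    exact (isFP k C).prop_of_iso (asIso (doubleDualHom c.pt)).symm (h.dualOp_mem ⟨_, dual_fp⟩)

lemma enoughInjectives : EnoughInjectives (FPModCat k C) := by
  have := h.krullSchmidt.hasFiniteBiproducts
  have := FPModCat.enoughProjectives k Cᵒᵖ
  have := h.isEquivalence_dualOp
  exact (Functor.asEquivalence ((isFP k C).lift ((isFP k Cᵒᵖ).ι.op ⋙ modDualOp k C)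
    fun N => h.dualOp_mem N.unop)).enoughInjectives_iff.1 inferInstance

end IsDualizingVariety

end Duality

section Ext

open Abelian

universe u₁ v₁ w₁ u₂ v₂ w₂

variable {A : Type u₁} [Category.{v₁} A] [Abelian A] {B : Type u₂} [Category.{v₂} B] [Abelian B]

section Functor

variable [HasExt.{w₁} A] [HasExt.{w₂} B] (F : A ⥤ B) [F.Additive] [PreservesFiniteLimits F]
  [PreservesFiniteColimits F] [F.Full] [F.Faithful]

lemma mapExtAddHom_zero_bijective (X Y : A) : Function.Bijective (F.mapExtAddHom X Y 0) := by
  simpa [Ext.mapExactFunctor₀] using ⟨F.map_injective, F.map_surjective⟩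

lemma mapExtAddHom_surjective_of_projective_map {P : A} (hP : Projective (F.obj P)) (Y : A)
    (n : ℕ) : Function.Surjective (F.mapExtAddHom P Y n) := by
  cases n with
  | zero => exact (mapExtAddHom_zero_bijective F P Y).2
  | succ n => exact fun y => ⟨0, (Ext.subsingleton_of_projective _ _ n).elim _ _⟩

lemma mapExtAddHom_surjective_of_injective_map (X : A) {J : A} (hJ : Injective (F.obj J))
    (n : ℕ) : Function.Surjective (F.mapExtAddHom X J n) := by
  cases n with
  | zero => exact (mapExtAddHom_zero_bijective F X J).2
  | succ n => exact fun y => ⟨0, (Ext.subsingleton_of_injective _ _ n).elim _ _⟩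

/- In both dimension shifts the connecting map out of degree `n` is onto because the middle term is
acyclic, and an element of its kernel comes from the middle term, where `F` is onto. -/
section DimensionShift

variable {S : ShortComplex A} (hS : S.ShortExact) (n : ℕ)
include hS

lemma mapExtAddHom_succ_bijective_of_projective (hP : Projective (F.obj S.X₂)) (Y : A)
    (hn : Function.Bijective (F.mapExtAddHom S.X₁ Y n)) :
    Function.Bijective (F.mapExtAddHom S.X₃ Y (n + 1)) := by
  have : Projective S.X₂ := F.projective_of_map_projective hP
  have : Projective (S.map F).X₂ := hP
  have hFS := hS.map_of_exact F
  have map_extClass_comp (x : Ext S.X₁ Y n) :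
      F.mapExtAddHom S.X₃ Y (n + 1) (hS.extClass.comp x (add_comm 1 n)) =
        hFS.extClass.comp (F.mapExtAddHom S.X₁ Y n x) (add_comm 1 n) := by
    simp only [Functor.mapExtAddHom_apply, Ext.mapExactFunctor_comp, Ext.mapExactFunctor_extClass]
    rfl
  refine ⟨(injective_iff_map_eq_zero _).2 fun x hx => ?_, fun y => ?_⟩
  · obtain ⟨x₁, rfl⟩ := Ext.contravariant_sequence_exact₃ hS Y x
      ((Ext.subsingleton_of_projective _ _ n).elim _ _) (add_comm 1 n)
    obtain ⟨y₂, hy₂⟩ := Ext.contravariant_sequence_exact₁ hFS (F.obj Y) _ (add_comm 1 n)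
      ((map_extClass_comp x₁).symm.trans hx)
    obtain ⟨x₂, rfl⟩ := mapExtAddHom_surjective_of_projective_map F hP Y n y₂
    have hx₂ : (Ext.mk₀ S.f).comp x₂ (zero_add n) = x₁ := hn.1 <| by
      simp only [← hy₂, Functor.mapExtAddHom_apply, Ext.mapExactFunctor_comp,
        Ext.mapExactFunctor_mk₀]
      rfl
    rw [← hx₂, hS.extClass_comp_assoc]
  · obtain ⟨y₁, rfl⟩ := Ext.contravariant_sequence_exact₃ hFS (F.obj Y) y
      ((Ext.subsingleton_of_projective _ _ n).elim _ _) (add_comm 1 n)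
    obtain ⟨x₁, rfl⟩ := hn.2 y₁
    exact ⟨_, map_extClass_comp x₁⟩

lemma mapExtAddHom_succ_bijective_of_injective (X : A) (hJ : Injective (F.obj S.X₂))
    (hn : Function.Bijective (F.mapExtAddHom X S.X₃ n)) :
    Function.Bijective (F.mapExtAddHom X S.X₁ (n + 1)) := by
  have : Injective S.X₂ := F.injective_of_map_injective hJ
  have : Injective (S.map F).X₂ := hJ
  have hFS := hS.map_of_exact F
  have map_comp_extClass (x : Ext X S.X₃ n) :
      F.mapExtAddHom X S.X₁ (n + 1) (x.comp hS.extClass rfl) =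
        (F.mapExtAddHom X S.X₃ n x).comp hFS.extClass rfl := by
    simp only [Functor.mapExtAddHom_apply, Ext.mapExactFunctor_comp, Ext.mapExactFunctor_extClass]
    rfl
  refine ⟨(injective_iff_map_eq_zero _).2 fun x hx => ?_, fun y => ?_⟩
  · obtain ⟨x₃, rfl⟩ := Ext.covariant_sequence_exact₁ X hS x
      ((Ext.subsingleton_of_injective _ _ n).elim _ _) rfl
    obtain ⟨y₂, hy₂⟩ := Ext.covariant_sequence_exact₃ (F.obj X) hFS _ rfl
      ((map_comp_extClass x₃).symm.trans hx)
    obtain ⟨x₂, rfl⟩ := mapExtAddHom_surjective_of_injective_map F X hJ n y₂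
    have hx₂ : x₂.comp (Ext.mk₀ S.g) (add_zero n) = x₃ := hn.1 <| by
      simp only [← hy₂, Functor.mapExtAddHom_apply, Ext.mapExactFunctor_comp,
        Ext.mapExactFunctor_mk₀]
      rfl
    rw [← hx₂, Ext.comp_assoc_of_second_deg_zero, hS.comp_extClass, Ext.comp_zero]
  · obtain ⟨y₃, rfl⟩ := Ext.covariant_sequence_exact₁ (F.obj X) hFS y
      ((Ext.subsingleton_of_injective _ _ n).elim _ _) rfl
    obtain ⟨x₃, rfl⟩ := hn.2 y₃
    exact ⟨_, map_comp_extClass x₃⟩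

end DimensionShift

variable (n : ℕ)

lemma mapExtAddHom_succ_bijective_of_projectivePresentation {a : A} {x : B}
    (P : ProjectivePresentation x) (e : F.obj a ≅ x) (hP : F.essImage P.p) (z : A)
    (hn : ∀ a', (F.obj a' ≅ kernel P.f) → Function.Bijective (F.mapExtAddHom a' z n)) :
    Function.Bijective (F.mapExtAddHom a z (n + 1)) := by
  obtain ⟨p, ⟨e'⟩⟩ := hP
  obtain ⟨f, hf⟩ := F.map_surjective (e'.hom ≫ P.f ≫ e.inv)
  have : Epi f := F.epi_of_epi_map (by rw [hf]; infer_instance)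
  have exact : (ShortComplex.mk _ _ (kernel.condition f)).ShortExact :=
    { exact := ShortComplex.exact_kernel f }
  exact mapExtAddHom_succ_bijective_of_projective F exact n (P.projective.of_iso e'.symm) z
    (hn _ (PreservesKernel.iso F f ≪≫ kernel.mapIso _ _ e' e (by simp [hf])))

lemma mapExtAddHom_succ_bijective_of_injectivePresentation {a : A} {y : B}
    (J : InjectivePresentation y) (e : F.obj a ≅ y) (hJ : F.essImage J.J) (z : A)
    (hn : ∀ a', (F.obj a' ≅ cokernel J.f) → Function.Bijective (F.mapExtAddHom z a' n)) :
    Function.Bijective (F.mapExtAddHom z a (n + 1)) := by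
  obtain ⟨j, ⟨e'⟩⟩ := hJ
  obtain ⟨f, hf⟩ := F.map_surjective (e.hom ≫ J.f ≫ e'.inv)
  have : Mono f := F.mono_of_mono_map (by rw [hf]; infer_instance)
  have exact : (ShortComplex.mk _ _ (cokernel.condition f)).ShortExact :=
    { exact := ShortComplex.exact_cokernel f }
  exact mapExtAddHom_succ_bijective_of_injective F exact n z (Injective.of_iso e'.symm J.injective)
    (hn _ (PreservesCokernel.iso F f ≪≫ cokernel.mapIso _ _ e e' (by simp [hf])))

end Functor

section System

variable {I : Type*} [Preorder I] [IsDirectedOrder I] {A : I → Type u₁} [∀ i, Category.{v₁} (A i)]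
  [∀ i, Abelian (A i)] [∀ i, HasExt.{w₁} (A i)] [HasExt.{w₂} B] (Ψ : ∀ i, A i ⥤ B)
  [∀ i, (Ψ i).Additive] [∀ i, PreservesFiniteLimits (Ψ i)] [∀ i, PreservesFiniteColimits (Ψ i)]
  [∀ i, (Ψ i).Full] [∀ i, (Ψ i).Faithful]

lemma exists_mapExtAddHom_bijective_left [EnoughProjectives B]
    (hΨ : ∀ x : B, ∃ t, ∀ u, t < u → (Ψ u).essImage x) (x : B) (n : ℕ) :
    ∃ t, ∀ u, t < u → ∀ a, ((Ψ u).obj a ≅ x) → ∀ z,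
      Function.Bijective ((Ψ u).mapExtAddHom a z n) := by
  induction n generalizing x with
  | zero =>
    obtain ⟨t, -⟩ := hΨ x
    exact ⟨t, fun u _ a _ z => mapExtAddHom_zero_bijective _ a z⟩
  | succ n ih =>
    let P : ProjectivePresentation x := Classical.arbitrary _
    obtain ⟨t₁, h₁⟩ := hΨ P.p
    obtain ⟨t₂, h₂⟩ := ih (kernel P.f)
    obtain ⟨t, ht₁, ht₂⟩ := exists_ge_ge t₁ t₂
    exact ⟨t, fun u hu a e z => mapExtAddHom_succ_bijective_of_projectivePresentation _ n P e
      (h₁ u (ht₁.trans_lt hu)) z fun a' e' => h₂ u (ht₂.trans_lt hu) a' e' z⟩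

lemma exists_mapExtAddHom_bijective_right [EnoughInjectives B]
    (hΨ : ∀ y : B, ∃ t, ∀ u, t < u → (Ψ u).essImage y) (y : B) (n : ℕ) :
    ∃ t, ∀ u, t < u → ∀ a, ((Ψ u).obj a ≅ y) → ∀ z,
      Function.Bijective ((Ψ u).mapExtAddHom z a n) := by
  induction n generalizing y with
  | zero =>
    obtain ⟨t, -⟩ := hΨ y
    exact ⟨t, fun u _ a _ z => mapExtAddHom_zero_bijective _ z a⟩
  | succ n ih =>
    let J : InjectivePresentation y := Classical.arbitrary _
    obtain ⟨t₁, h₁⟩ := hΨ J.J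
    obtain ⟨t₂, h₂⟩ := ih (cokernel J.f)
    obtain ⟨t, ht₁, ht₂⟩ := exists_ge_ge t₁ t₂
    exact ⟨t, fun u hu a e z => mapExtAddHom_succ_bijective_of_injectivePresentation _ n J e
      (h₁ u (ht₁.trans_lt hu)) z fun a' e' => h₂ u (ht₂.trans_lt hu) a' e' z⟩

end System

/-- The `R`-linear equivalence of `Ext`-modules induced by isomorphisms in both variables. -/
def extLinearEquivOfIso (R : Type*) [Ring R] [Linear R A] [HasExt.{w₁} A] {X X' Y Y' : A}
    (e : X ≅ X') (e' : Y ≅ Y') (n : ℕ) : Ext X Y n ≃ₗ[R] Ext X' Y' n where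
  toFun x := ((Ext.mk₀ e.inv).comp x (zero_add n)).comp (Ext.mk₀ e'.hom) (add_zero n)
  invFun x := ((Ext.mk₀ e.hom).comp x (zero_add n)).comp (Ext.mk₀ e'.inv) (add_zero n)
  map_add' x y := by simp
  map_smul' r x := by simp
  left_inv x := by simp
  right_inv x := by simp

end Ext

section ExtAdjunction

open Abelian

universe u₁ v₁ w₁ u₂ v₂ w₂

variable {I : Type*} [Preorder I] [IsDirectedOrder I] {A : I → Type u₁} [∀ i, Category.{v₁} (A i)]
  [∀ i, Abelian (A i)] [∀ i, HasExt.{w₁} (A i)] {B : Type u₂} [Category.{v₂} B] [Abelian B]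
  [HasExt.{w₂} B] {Ψ : ∀ i, A i ⥤ B} [∀ i, (Ψ i).Additive] [∀ i, PreservesFiniteLimits (Ψ i)]
  [∀ i, PreservesFiniteColimits (Ψ i)] [∀ i, (Ψ i).Full] [∀ i, (Ψ i).Faithful]
  (R : Type*) [Ring R] [∀ i, Linear R (A i)] [Linear R B] [∀ i, (Ψ i).Linear R]

lemma exists_extLinearEquiv_leftAdjoint [EnoughProjectives B] {L : ∀ i, B ⥤ A i}
    (adj : ∀ i, L i ⊣ Ψ i) (hΨ : ∀ x : B, ∃ t, ∀ u, t < u → (Ψ u).essImage x) (x : B) (n : ℕ) :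
    ∃ t, ∀ u, t < u → ∀ z, ∀ r < n,
      Nonempty (Ext x ((Ψ u).obj z) r ≃ₗ[R] Ext ((L u).obj x) z r) := by
  choose t ht using exists_mapExtAddHom_bijective_left Ψ hΨ x
  obtain ⟨t₁, ht₁⟩ := hΨ x
  have : Nonempty I := ⟨t₁⟩
  obtain ⟨t₂, ht₂⟩ := Finite.exists_le fun r : Fin n => t r
  obtain ⟨s, hs₁, hs₂⟩ := exists_ge_ge t₁ t₂
  refine ⟨s, fun u hu z r hr => ?_⟩
  have := (adj u).isIso_unit_app_iff_mem_essImage.2 (ht₁ u (hs₁.trans_lt hu))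
  let e : x ≅ (Ψ u).obj ((L u).obj x) := asIso ((adj u).unit.app x)
  have bijective : Function.Bijective ((Ψ u).mapExtLinearMap R ((L u).obj x) z r) :=
    ht r u (((ht₂ ⟨r, hr⟩).trans hs₂).trans_lt hu) _ e.symm z
  exact ⟨(extLinearEquivOfIso R e (Iso.refl _) r).trans (.symm (.ofBijective _ bijective))⟩

lemma exists_extLinearEquiv_rightAdjoint [EnoughInjectives B] {K : ∀ i, B ⥤ A i}
    (adj : ∀ i, Ψ i ⊣ K i) (hΨ : ∀ y : B, ∃ t, ∀ u, t < u → (Ψ u).essImage y) (y : B) (n : ℕ) :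
    ∃ t, ∀ u, t < u → ∀ z, ∀ r < n,
      Nonempty (Ext ((Ψ u).obj z) y r ≃ₗ[R] Ext z ((K u).obj y) r) := by
  choose t ht using exists_mapExtAddHom_bijective_right Ψ hΨ y
  obtain ⟨t₁, ht₁⟩ := hΨ y
  have : Nonempty I := ⟨t₁⟩
  obtain ⟨t₂, ht₂⟩ := Finite.exists_le fun r : Fin n => t r
  obtain ⟨s, hs₁, hs₂⟩ := exists_ge_ge t₁ t₂
  refine ⟨s, fun u hu z r hr => ?_⟩
  have := (adj u).isIso_counit_app_iff_mem_essImage.2 (ht₁ u (hs₁.trans_lt hu))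
  let e : (Ψ u).obj ((K u).obj y) ≅ y := asIso ((adj u).counit.app y)
  have bijective : Function.Bijective ((Ψ u).mapExtLinearMap R z ((K u).obj y) r) :=
    ht r u (((ht₂ ⟨r, hr⟩).trans hs₂).trans_lt hu) _ e z
  exact ⟨(extLinearEquivOfIso R (Iso.refl _) e.symm r).trans (.symm (.ofBijective _ bijective))⟩

end ExtAdjunction

section Admissible

namespace DirectSystem.Target

variable {I : Type u} [Preorder I] {A : I → Type w} [∀ i, Category.{v} (A i)]
  {S : DirectSystem I A} {B : Type w'} [Category.{v'} B] (T : S.Target B) {i j : I} (h : i < j)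
include T

lemma full_G [(T.Ψ i).Full] [(T.Ψ j).Faithful] : (S.G h).Full :=
  .of_comp_faithful_iso (T.Z h)

lemma faithful_G [(T.Ψ i).Faithful] : (S.G h).Faithful :=
  .of_comp_iso (T.Z h)

lemma preservesFiniteLimits_G [PreservesFiniteLimits (T.Ψ i)] [(T.Ψ j).Full] [(T.Ψ j).Faithful] :
    PreservesFiniteLimits (S.G h) :=
  have := preservesFiniteLimits_of_natIso (T.Z h).symm
  preservesFiniteLimits_of_reflects_of_preserves _ (T.Ψ j)

lemma preservesFiniteColimits_G [PreservesFiniteColimits (T.Ψ i)] [(T.Ψ j).Full]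
    [(T.Ψ j).Faithful] : PreservesFiniteColimits (S.G h) :=
  have := preservesFiniteColimits_of_natIso (T.Z h).symm
  preservesFiniteColimits_of_reflects_of_preserves _ (T.Ψ j)

end DirectSystem.Target

theorem isAdmissibleTarget_of_mem_essImage (R : Type uR) [Ring R] {I : Type u} [Preorder I]
    [IsDirectedOrder I] {A : I → Type w} [∀ i, Category.{v} (A i)] [∀ i, Preadditive (A i)]
    [∀ i, Linear R (A i)] {S : DirectSystem I A} {B : Type w'} [Category.{v'} B] [Preadditive B]
    [Linear R B] (T : S.Target B) {L K : ∀ i, B ⥤ A i} (adjL : ∀ i, L i ⊣ T.Ψ i)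
    (adjK : ∀ i, T.Ψ i ⊣ K i) (hA : ∀ i, IsAbelianCat (A i)) (hB : IsAbelianCat B)
    [∀ i, (T.Ψ i).Additive] [∀ i, (T.Ψ i).Linear R] [∀ i, (T.Ψ i).Full] [∀ i, (T.Ψ i).Faithful]
    [EnoughProjectives B] [EnoughInjectives B]
    (hΨ : ∀ x : B, ∃ t, ∀ u, t < u → (T.Ψ u).essImage x) :
    IsAdmissibleTarget R T adjL adjK := by
  let := fun i => (hA i).toAbelian
  let := hB.toAbelian
  have := fun i => HasExt.standard (A i)
  have := HasExt.standard B
  have (i : I) : PreservesFiniteLimits (T.Ψ i) :=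
    have := (adjL i).rightAdjoint_preservesLimits
    inferInstance
  have (i : I) : PreservesFiniteColimits (T.Ψ i) :=
    have := (adjK i).leftAdjoint_preservesColimits
    inferInstance
  refine ⟨hA, fun h => T.full_G h, fun h => T.faithful_G h, fun h => T.preservesFiniteLimits_G h,
    fun h => T.preservesFiniteColimits_G h, hB,
    inferInstance, inferInstance, fun x => ?_, fun x n _ => ?_, fun y n _ => ?_⟩
  · obtain ⟨t, ht⟩ := hΨ x
    exact ⟨t, fun u hu => ⟨(adjL u).isIso_unit_app_iff_mem_essImage.2 (ht u hu),
      (adjK u).isIso_counit_app_iff_mem_essImage.2 (ht u hu)⟩⟩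
  · obtain ⟨t, ht⟩ := exists_extLinearEquiv_leftAdjoint R adjL hΨ x n
    exact ⟨t, fun u hu z r _ hr => ht u hu z r hr⟩
  · obtain ⟨t, ht⟩ := exists_extLinearEquiv_rightAdjoint R adjK hΨ y n
    exact ⟨t, fun u hu z r _ hr => ht u hu z r hr⟩

end Admissible

section Sources

variable {I : Type u} [Preorder I] {C : I → Type w} [∀ i, Category.{v} (C i)]
  {S : InverseSystem I C}

lemma InverseSystem.Limit.Hom.app_eq_of_lt {a x : S.Limit} {s s' : a ⟶ x} {i j : I} (h : i < j)
    (hj : s.app j = s'.app j) : s.app i = s'.app i := by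
  rw [← cancel_epi (a.iso h).hom, s.comm h, s'.comm h, hj]

/- Firmness at `x` makes `F_tw` faithful on maps into `x_w` for large `w`, so that the component at
`t` determines the one at `w`, and hence those at all indices below `w`. -/
lemma InverseSystem.isFirm.exists_hom_ext [IsDirectedOrder I] {x : S.Limit} (hx : S.isFirm x) :
    ∃ t, ∀ u, t < u → ∀ (a : S.Limit) (s s' : a ⟶ x), s.app u = s'.app u → s = s' := by
  by_cases hI : ∃ t : I, IsMax t
  · exact hI.imp fun t ht u hu => (ht.not_lt hu).elim
  simp only [not_exists, not_isMax_iff] at hI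
  obtain ⟨t, ht⟩ := hx
  refine ⟨t, fun u hu a s s' h => Limit.Hom.ext (funext fun i => ?_)⟩
  obtain ⟨v, hiv, htv⟩ := exists_ge_ge i t
  obtain ⟨w, hvw⟩ := hI v
  have htw := htv.trans_lt hvw
  have app_w : s.app w = s'.app w := ((ht w htw).2 _).1 <| by
    change (S.F htw).map (s.app w) = (S.F htw).map (s'.app w)
    rw [← cancel_mono (x.iso htw).hom, ← s.comm htw, ← s'.comm htw,
      Limit.Hom.app_eq_of_lt hu h]
  exact Limit.Hom.app_eq_of_lt (hiv.trans_lt hvw) app_w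

lemma InverseSystem.Firm.exists_firmSource_map_injective [IsDirectedOrder I] (x : S.Firm) :
    ∃ t, ∀ u, t < u → ∀ a : S.Firm, Function.Injective ((S.firmSource.Φ u).map (X := a) (Y := x)) :=
  (isFirm.exists_hom_ext x.property).imp fun _ ht u hu _ _ _ h =>
    ObjectProperty.hom_ext _ (ht u hu _ _ _ h)

end Sources

section EventuallyFaithful

variable {k : Type u} [Field k] {E : Type u} [Category.{u} E] [Preadditive E] [Linear k E]

lemma AnnihilatedByKer.of_epi {D : Type u} [Category.{u} D] [Preadditive D] {F : E ⥤ D}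
    {N M : ModCat k E} (hN : AnnihilatedByKer F N) (p : N ⟶ M) [Epi p] :
    AnnihilatedByKer F M := by
  intro x y f hf
  have := (ModuleCat.epi_iff_surjective _).2 ((ModCat.epi_iff_surjective_app p).1 ‹_› (op y))
  rw [← cancel_epi (p.hom.app (op y)), ← p.hom.naturality, hN f hf, zero_comp, comp_zero]

lemma annihilatedByKer_yonedaMod {D : Type u} [Category.{u} D] [Preadditive D] {F : E ⥤ D}
    [F.PreservesZeroMorphisms] {x : E}
    (hF : ∀ a, Function.Injective (F.map (X := a) (Y := x))) :
    AnnihilatedByKer F ((yonedaMod k E).obj x) := by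
  intro a b f hf
  refine ModuleCat.hom_ext (LinearMap.ext fun (g : b ⟶ x) => hF a (?_ : F.map (f ≫ g) = F.map 0))
  rw [F.map_comp, hf, zero_comp, F.map_zero]

lemma exists_annihilatedByKer {I : Type u} [Preorder I] {C : I → Type u}
    [∀ i, Category.{u} (C i)] [∀ i, Preadditive (C i)] {Φ : ∀ i, E ⥤ C i}
    [∀ i, (Φ i).PreservesZeroMorphisms]
    (hΦ : ∀ x, ∃ t, ∀ u, t < u → ∀ a, Function.Injective ((Φ u).map (X := a) (Y := x)))
    {M : ModCat k E} (hM : isFP k E M) : ∃ t, ∀ u, t < u → AnnihilatedByKer (Φ u) M := by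
  obtain ⟨x, y, g, p, hp⟩ := isFP_iff_exists_isCokernel.1 hM
  have := hp.epi
  obtain ⟨t, ht⟩ := hΦ x
  exact ⟨t, fun u hu => (annihilatedByKer_yonedaMod (ht u hu)).of_epi p⟩

end EventuallyFaithful

end

end AdmTarget

open AdmTarget in
theorem mainTheorem5_general {k : Type u} [Field k] {I : Type u} [Preorder I] [IsDirectedOrder I]
    {C : I → Type u} [∀ i, Category.{u} (C i)] [∀ i, Preadditive (C i)] [∀ i, Linear k (C i)]
    {S : InverseSystem I C}
    [∀ (i j : I) (h : i < j), (S.F h).Additive] [∀ (i j : I) (h : i < j), (S.F h).Linear k]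
    (hF : ∀ (i j : I) (h : i < j), IsCoherentPreserving k (S.F h))
    {E : Type u} [Category.{u} E] [Preadditive E] [Linear k E] [HasFiniteBiproducts E]
    [(isFP k E).IsClosedUnderKernels] [EnoughInjectives (FPModCat k E)] (T : S.Source E)
    [∀ i, (T.Φ i).Additive] [∀ i, (T.Φ i).Linear k] [∀ i, (T.Φ i).EssSurj] [∀ i, (T.Φ i).Full]
    (hΦ : ∀ i, IsCoherentPreserving k (T.Φ i))
    (hinj : ∀ x, ∃ t, ∀ u, t < u → ∀ a, Function.Injective ((T.Φ u).map (X := a) (Y := x))) :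
    ∃ hInd : ∀ (i : I) (M : FPModCat k E), isFP k (C i) ((ind k (T.Φ i)).obj M.obj),
      IsAdmissibleTarget k (modTarget k hF T hΦ) (fun i => fpIndAdj k (hInd i) (hΦ i))
        (fun i => fpCoindAdj k (hΦ i)) := by
  have (i : I) : ((modTarget k hF T hΦ).Ψ i).Additive :=
    inferInstanceAs (fpRestr k (hΦ i)).Additive
  have (i : I) : ((modTarget k hF T hΦ).Ψ i).Linear k :=
    inferInstanceAs ((fpRestr k (hΦ i)).Linear k)
  have (i : I) : ((modTarget k hF T hΦ).Ψ i).Full := inferInstanceAs (fpRestr k (hΦ i)).Full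
  have (i : I) : ((modTarget k hF T hΦ).Ψ i).Faithful :=
    inferInstanceAs (fpRestr k (hΦ i)).Faithful
  have := FPModCat.enoughProjectives k E
  refine ⟨fun i M => isFP_ind _ M.property, isAdmissibleTarget_of_mem_essImage k _ _ _
    (fun i => isAbelianCat_FPModCat_of_restr (T.Φ i) (hΦ i).restr_mem) isAbelianCat_of_abelian
    fun M => ?_⟩
  obtain ⟨t, ht⟩ := exists_annihilatedByKer hinj M.property
  exact ⟨t, fun u hu => (ht u hu).mem_essImage_fpRestr (hΦ u)⟩

theorem mainTheorem5 {k : Type u} [Field k] {I : Type u} [Preorder I] [IsDirectedOrder I]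
    {C : I → Type u} [∀ i, Category.{u} (C i)] [∀ i, Preadditive (C i)] [∀ i, Linear k (C i)]
    (S : AdmTarget.InverseSystem I C)
    [∀ (i j : I) (h : i < j), (S.F h).Additive] [∀ (i j : I) (h : i < j), (S.F h).Linear k]
    (hC : ∀ i, AdmTarget.IsDualizingVariety k (C i))
    (hF : ∀ (i j : I) (h : i < j), AdmTarget.IsCoherentPreserving k (S.F h))
    (hFirm : AdmTarget.IsDualizingVariety k S.Firm)
    (hDense : ∀ i, (S.firmSource.Φ i).EssSurj)
    (hFull : ∀ i, (S.firmSource.Φ i).Full)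
    (hΦ : ∀ i, AdmTarget.IsCoherentPreserving k (S.firmSource.Φ i)) :
    ∃ hInd : ∀ (i : I) (M : AdmTarget.FPModCat k S.Firm),
        AdmTarget.isFP k (C i) ((AdmTarget.ind k (S.firmSource.Φ i)).obj M.obj),
      AdmTarget.IsAdmissibleTarget k (AdmTarget.modTarget k hF S.firmSource hΦ)
        (fun i => AdmTarget.fpIndAdj k (hInd i) (hΦ i))
        (fun i => AdmTarget.fpCoindAdj k (hΦ i)) := by
  have := hFirm.krullSchmidt.hasFiniteBiproducts
  have := hFirm.isClosedUnderKernels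
  have := hFirm.enoughInjectives
  exact mainTheorem5_general hF S.firmSource hΦ
    AdmTarget.InverseSystem.Firm.exists_firmSource_map_injective
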